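/- Let $r\ge 1$ be an integer, $a>0$ and $\mathbf w=(w_1,\dots,w_r)\in\mathbb{R}_{>0}^r$. The series $$\zeta_r(s,a,\mathbf w)=\sum_{m_1,\dots,m_r\ge 0}\frac{1}{(a+m_1w_1+\cdots+m_rw_r)^{s}}$$ converges absolutely for $\operatorname{Re}s>r$ and has a meromorphic continuation to $\mathbb{C}$, again denoted $\zeta_r(s,a,\mathbf w)$ (the Barnes multiple zeta function), which is holomorphic away from $s=1,2,\dots,r$. Write $s=\sigma+it$. Then for all $t\ge 2$ $$ \zeta_r(\sigma+it,a,\mathbf w)\ll \begin{cases} 1 & \text{if } \sigma>r,\\ t^{(r-\sigma)/2}\log t & \text{if } r-1<\sigma\le r,\\ t^{\,r-\sigma-1/2}\log t & \text{if } \sigma\le r-1. \end{cases} $$ The implied constants depend on $a$, $r$, $\mathbf w$ and the following range of $\sigma$. In the first case, for any $r<\sigma_0\le\sigma_1$, the bound is uniform in $\sigma_0\le\sigma\le\sigma_1$, with a constant depending also on $\sigma_0,\sigma_1$. In the second case it is uniform in the whole strip $r-1<\sigma\le r$, with a constant depending only on $a,r,\mathbf w$. In the third case, for any $\sigma_0\le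 r-1$, it is uniform in $\sigma_0\le\sigma\le r-1$, with a constant depending also on $\sigma_0$. -/

import Mathlib

/-- `Z` is the meromorphic continuation to `ℂ` of the Barnes multiple zeta series
`∑_{m ∈ ℕ^r} (a + m₁ w₁ + ⋯ + m_r w_r)^{-s}`: the series converges (absolutely) to `Z s` for
`Re s > r`, and `Z` is meromorphic on `ℂ` and holomorphic away from `s = 1, …, r`.
By the identity theorem such a `Z` is unique away from `1, …, r`. -/
structure IsBarnesContinuation (r : ℕ) (a : ℝ) (w : Fin r → ℝ) (Z : ℂ → ℂ) : Prop where
  hasSum : ∀ s : ℂ, (r : ℝ) < s.re →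
    HasSum (fun m : Fin r → ℕ ↦ 1 / ((a + ∑ j, (m j : ℝ) * w j : ℝ) : ℂ) ^ s) (Z s)
  meromorphic : Meromorphic Z
  differentiableOn : DifferentiableOn ℂ Z {s : ℂ | ∀ k : ℕ, 1 ≤ k → k ≤ r → s ≠ (k : ℂ)}

open Classical in
/-- The Barnes multiple zeta function `ζ_r(s, a, w)` on the whole complex plane. The values at the
points `s = 1, …, r` are arbitrary; the fallback value `0` matters only if no continuation exists,
which does not happen for `r ≥ 1` and `a, w_j > 0`. -/
noncomputable def barnesZeta (r : ℕ) (a : ℝ) (w : Fin r → ℝ) : ℂ → ℂ :=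
  if h : ∃ Z : ℂ → ℂ, IsBarnesContinuation r a w Z then h.choose else 0

/-!
Write `w = (w₁, v)`. Telescoping in the first variable gives
`ζ_r(s, x, w) - ζ_r(s, x + w₁, w) = ζ_{r-1}(s, x, v)`; at `s - 1`, the first-order Taylor expansion
of the left-hand side in the shift, with integral remainder, turns this into
`w₁ ζ_r(s, x, w) = ζ_{r-1}(s - 1, x, v) / (s - 1) + s ∫₀^{w₁} (w₁ - u) ζ_r(s + 1, x + u, w) du`,
which continues `ζ_r` one strip to the left at a time.

For shifts `x` larger than a multiple of `|s|` the integral is a small perturbation, and iterating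
the recursion gives `ζ_r(s, x) ≪ x^{r-σ} / t`. Telescoping up to such shifts approximates
`ζ_r(s, a)` by the sum over a box of side `≍ t`, with error `O(t^{r-1-σ})`. In a dyadic shell where
the affine form is of size `M ≪ t`, there are `O(M^{r-1})` choices of the outer indices, and the
second-derivative test (from the Kusmin–Landau inequality) bounds the remaining sum over an
arithmetic progression by `O(M^{-σ} min(M, √t))`. There are `O(log t)` shells, and maximizing
`M^{r-1-σ} min(M, √t)` over `M ≪ t` gives the exponents of the theorem.
-/

open Set Filter Topology MeasureTheory

theorem continuousOn_intervalIntegral_of_continuousOn {X E : Type*} [TopologicalSpace X]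
    [NormedAddCommGroup E] [NormedSpace ℝ E] {V : Set X} {a b : ℝ} {f : X → ℝ → E}
    (hf : ContinuousOn (fun p : X × ℝ ↦ f p.1 p.2) (V ×ˢ uIcc a b)) :
    ContinuousOn (fun s ↦ ∫ u in a..b, f s u) V := by
  have hext : ∀ s, ∫ u in a..b, f s u = ∫ u in a..b, f s (projIcc (a ⊓ b) (a ⊔ b) inf_le_sup u) :=
    fun s ↦ intervalIntegral.integral_congr fun u hu ↦ by
      simp only [projIcc_of_mem inf_le_sup hu]
  simp only [continuousOn_iff_continuous_domRestrict, hext]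
  refine intervalIntegral.continuous_parametric_intervalIntegral_of_continuous' ?_ _ _
  exact hf.comp_continuous
    (f := fun q : V × ℝ ↦ (q.1.1, (projIcc (a ⊓ b) (a ⊔ b) inf_le_sup q.2 : ℝ)))
    (by fun_prop) fun q ↦ ⟨q.1.2, Subtype.coe_prop _⟩

theorem intervalIntegral_swap_of_continuousOn {E : Type*} [NormedAddCommGroup E] [NormedSpace ℝ E]
    {a b c d : ℝ} {f : ℝ → ℝ → E}
    (hf : ContinuousOn (fun p : ℝ × ℝ ↦ f p.1 p.2) (uIcc a b ×ˢ uIcc c d)) :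
    ∫ x in a..b, ∫ y in c..d, f x y = ∫ y in c..d, ∫ x in a..b, f x y := by
  refine intervalIntegral_intervalIntegral_swap ?_
  exact (hf.integrableOn_compact (isCompact_uIcc.prod isCompact_uIcc)).mono_set
    (prod_mono uIoc_subset_uIcc uIoc_subset_uIcc)

theorem wedgeIntegral_intervalIntegral {E : Type*} [NormedAddCommGroup E] [NormedSpace ℂ E]
    {z w : ℂ} {a b : ℝ} {f : ℂ → ℝ → E}
    (hf : ContinuousOn (fun p : ℂ × ℝ ↦ f p.1 p.2) (Complex.Rectangle z w ×ˢ uIcc a b)) :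
    Complex.wedgeIntegral z w (fun s ↦ ∫ u in a..b, f s u) =
      ∫ u in a..b, Complex.wedgeIntegral z w (fun s ↦ f s u) := by
  have hre : ContinuousOn (fun p : ℝ × ℝ ↦ f (p.1 + z.im * Complex.I) p.2)
      (uIcc z.re w.re ×ˢ uIcc a b) :=
    hf.comp (f := fun p : ℝ × ℝ ↦ ((p.1 + z.im * Complex.I : ℂ), p.2)) (by fun_prop) fun p hp ↦
      ⟨by simpa [Complex.Rectangle, Complex.mem_reProdIm] using hp.1, hp.2⟩
  have him : ContinuousOn (fun p : ℝ × ℝ ↦ f (w.re + p.1 * Complex.I) p.2)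
      (uIcc z.im w.im ×ˢ uIcc a b) :=
    hf.comp (f := fun p : ℝ × ℝ ↦ ((w.re + p.1 * Complex.I : ℂ), p.2)) (by fun_prop) fun p hp ↦
      ⟨by simpa [Complex.Rectangle, Complex.mem_reProdIm] using hp.1, hp.2⟩
  have integrable {g : ℝ → ℝ → E} {c d : ℝ}
      (hg : ContinuousOn (fun p : ℝ × ℝ ↦ g p.1 p.2) (uIcc c d ×ˢ uIcc a b)) :
      IntervalIntegrable (fun u ↦ ∫ x in c..d, g x u) volume a b :=
    (continuousOn_intervalIntegral_of_continuousOn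
      (hg.comp (f := Prod.swap) continuous_swap.continuousOn
        fun _ hp ↦ hp.symm)).intervalIntegrable
  simp only [Complex.wedgeIntegral]
  rw [intervalIntegral_swap_of_continuousOn hre,
    intervalIntegral_swap_of_continuousOn (f := fun y u ↦ f (w.re + y * Complex.I) u) him,
    ← intervalIntegral.integral_smul]
  exact (intervalIntegral.integral_add (integrable hre) ((integrable him).smul Complex.I)).symm

theorem differentiableOn_intervalIntegral_of_continuousOn {E : Type*} [NormedAddCommGroup E]
    [NormedSpace ℂ E] [CompleteSpace E] {V : Set ℂ} (hV : IsOpen V) {a b : ℝ} {f : ℂ → ℝ → E}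
    (hc : ContinuousOn (fun p : ℂ × ℝ ↦ f p.1 p.2) (V ×ˢ uIcc a b))
    (hd : ∀ u ∈ uIcc a b, DifferentiableOn ℂ (fun s ↦ f s u) V) :
    DifferentiableOn ℂ (fun s ↦ ∫ u in a..b, f s u) V := by
  -- Morera's theorem: by Fubini, rectangle integrals of the integral vanish with those of `f · u`.
  refine (Complex.isConservativeOn_and_continuousOn_iff_isDifferentiableOn hV).1
    ⟨fun z w hzw ↦ ?_, continuousOn_intervalIntegral_of_continuousOn hc⟩
  have hwz : Complex.Rectangle w z ⊆ V := by
    rwa [Complex.Rectangle, uIcc_comm w.re, uIcc_comm w.im]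
  rw [wedgeIntegral_intervalIntegral (hc.mono (prod_mono_left hzw)),
    wedgeIntegral_intervalIntegral (hc.mono (prod_mono_left hwz)), ← intervalIntegral.integral_neg]
  exact intervalIntegral.integral_congr fun u hu ↦ (hd u hu).isConservativeOn z w hzw

/-- The value `x + m₁ w₁ + ⋯ + m_r w_r` of the affine form whose powers are summed in the Barnes
zeta function. -/
def barnesForm {r : ℕ} (w : Fin r → ℝ) (x : ℝ) (m : Fin r → ℕ) : ℝ := x + ∑ j, (m j : ℝ) * w j

/-- The splitting of a summation index `m` into `(m₂, …, m_{r+1})` and `m₁`, in this order, so that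
the sum over `m₁` is the inner one. -/
def finConsEquiv (r : ℕ) : (Fin r → ℕ) × ℕ ≃ (Fin (r + 1) → ℕ) :=
  (Equiv.prodComm _ _).trans (Fin.consEquiv (fun _ ↦ ℕ))

section BarnesForm

variable {r : ℕ} {w : Fin r → ℝ} {x : ℝ}

theorem barnesForm_finConsEquiv (w : Fin (r + 1) → ℝ) (x : ℝ) (q : (Fin r → ℕ) × ℕ) :
    barnesForm w x (finConsEquiv r q) = barnesForm (Fin.tail w) x q.1 + q.2 * w 0 := by
  simp only [barnesForm, finConsEquiv, Equiv.trans_apply, Equiv.prodComm_apply, Prod.fst_swap,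
    Prod.snd_swap, Fin.consEquiv_apply, Fin.sum_univ_succ, Fin.cons_zero, Fin.cons_succ, Fin.tail]
  ring

theorem barnesForm_add (w : Fin r → ℝ) (x u : ℝ) (m : Fin r → ℕ) :
    barnesForm w (x + u) m = barnesForm w x m + u := by
  simp only [barnesForm]; ring

theorem le_barnesForm (hw : ∀ j, 0 < w j) (x : ℝ) (m : Fin r → ℕ) : x ≤ barnesForm w x m :=
  le_add_of_nonneg_right (Finset.sum_nonneg fun j _ ↦ mul_nonneg (Nat.cast_nonneg _) (hw j).le)

theorem barnesForm_pos (hw : ∀ j, 0 < w j) (hx : 0 < x) (m : Fin r → ℕ) : 0 < barnesForm w x m :=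
  hx.trans_le (le_barnesForm hw x m)

end BarnesForm

theorem mul_rpow_neg_add_one_le_rpow_neg_sub {u v q : ℝ} (hu : 0 < u) (hv : 0 < v) (hq : 0 ≤ q) :
    q * (v - u) * v ^ (-(q + 1)) ≤ u ^ (-q) - v ^ (-q) := by
  have bernoulli : 1 + q * (1 - u / v) ≤ (u / v) ^ (-q) := by
    have hlog := Real.log_le_sub_one_of_pos (div_pos hu hv)
    rw [Real.rpow_def_of_pos (div_pos hu hv)]
    nlinarith [Real.add_one_le_exp (Real.log (u / v) * -q)]
  calc q * (v - u) * v ^ (-(q + 1)) = (1 + q * (1 - u / v) - 1) * v ^ (-q) := by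
        rw [show -(q + 1) = -q - 1 by ring, Real.rpow_sub_one hv.ne']
        field_simp
        ring
    _ ≤ ((u / v) ^ (-q) - 1) * v ^ (-q) := by gcongr
    _ = u ^ (-q) - v ^ (-q) := by
        rw [Real.div_rpow hu.le hv.le, sub_mul, one_mul,
          div_mul_cancel₀ _ (Real.rpow_pos_of_pos hv _).ne']

section OneVariable

variable {x₀ y w p : ℝ}

theorem sum_range_rpow_add_mul_le (hy : 0 < y) (hw : 0 < w) (hp : 1 < p) (n : ℕ) :
    ∑ i ∈ Finset.range n, (y + (i + 1 : ℕ) * w) ^ (-p) ≤ y ^ (1 - p) / (w * (p - 1)) := by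
  have hpos (i : ℕ) : 0 < y + i * w := by positivity
  have term_le (i : ℕ) : w * (p - 1) * (y + (i + 1 : ℕ) * w) ^ (-p) ≤
      (y + i * w) ^ (1 - p) - (y + (i + 1 : ℕ) * w) ^ (1 - p) := by
    convert mul_rpow_neg_add_one_le_rpow_neg_sub (hpos i) (hpos (i + 1)) (sub_pos.2 hp).le
      using 2
    · push_cast; ring
    · ring_nf
    · ring_nf
    · ring_nf
  rw [le_div_iff₀' (mul_pos hw (sub_pos.2 hp)), Finset.mul_sum]
  calc ∑ i ∈ Finset.range n, w * (p - 1) * (y + (i + 1 : ℕ) * w) ^ (-p)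
      ≤ ∑ i ∈ Finset.range n, ((y + i * w) ^ (1 - p) - (y + (i + 1 : ℕ) * w) ^ (1 - p)) :=
        Finset.sum_le_sum fun i _ ↦ term_le i
    _ = y ^ (1 - p) - (y + n * w) ^ (1 - p) := by
        rw [Finset.sum_range_sub' fun i : ℕ ↦ (y + i * w) ^ (1 - p)]; simp
    _ ≤ y ^ (1 - p) := sub_le_self _ (Real.rpow_nonneg (hpos n).le _)

theorem summable_rpow_add_mul (hy : 0 < y) (hw : 0 < w) (hp : 1 < p) :
    Summable fun n : ℕ ↦ (y + n * w) ^ (-p) :=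
  (summable_nat_add_iff 1).1 <| summable_of_sum_range_le
    (fun n ↦ Real.rpow_nonneg (by positivity) _) (sum_range_rpow_add_mul_le hy hw hp)

theorem tsum_rpow_add_mul_le (hx₀ : 0 < x₀) (hy : x₀ ≤ y) (hw : 0 < w) (hp : 1 < p) :
    ∑' n : ℕ, (y + n * w) ^ (-p) ≤ (1 / x₀ + 1 / (w * (p - 1))) * y ^ (-(p - 1)) := by
  have hy0 := hx₀.trans_le hy
  rw [(summable_rpow_add_mul hy0 hw hp).tsum_eq_zero_add, add_mul]
  refine add_le_add ?_ ?_
  · rw [Nat.cast_zero, zero_mul, add_zero, show -p = -(p - 1) - 1 by ring,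
      Real.rpow_sub_one hy0.ne', div_eq_inv_mul, one_div]
    gcongr
  · refine (Real.tsum_le_of_sum_range_le (fun n ↦ Real.rpow_nonneg (by positivity) _)
      (sum_range_rpow_add_mul_le hy0 hw hp)).trans_eq ?_
    rw [neg_sub]
    ring

end OneVariable

theorem summable_prod_of_tsum_fiber_le {α β : Type*} {f : α × β → ℝ} {g : α → ℝ} (hf : 0 ≤ f)
    (hfib : ∀ a, Summable fun b ↦ f (a, b)) (hle : ∀ a, ∑' b, f (a, b) ≤ g a) (hg : Summable g) :
    Summable f ∧ ∑' q, f q ≤ ∑' a, g a := by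
  have houter : Summable fun a ↦ ∑' b, f (a, b) :=
    hg.of_nonneg_of_le (fun a ↦ tsum_nonneg fun b ↦ hf (a, b)) hle
  have hsum := (summable_prod_of_nonneg hf).2 ⟨hfib, houter⟩
  exact ⟨hsum, (hsum.tsum_prod' hfib).trans_le (houter.tsum_le_tsum hle hg)⟩

theorem exists_summable_rpow_barnesForm_and_tsum_le {r : ℕ} {w : Fin r → ℝ} (hw : ∀ j, 0 < w j)
    {p x₀ : ℝ} (hp : r < p) (hx₀ : 0 < x₀) :
    ∃ A : ℝ, 0 ≤ A ∧ ∀ x, x₀ ≤ x → Summable (fun m ↦ barnesForm w x m ^ (-p)) ∧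
      ∑' m, barnesForm w x m ^ (-p) ≤ A * x ^ (r - p) := by
  induction r generalizing p with
  | zero =>
    exact ⟨1, zero_le_one, fun x _ ↦ ⟨(hasSum_fintype _).summable, by simp [barnesForm]⟩⟩
  | succ r ih =>
    push_cast at hp
    have hw' (j) : 0 < Fin.tail w j := hw j.succ
    have hp1 : 1 < p := by linarith [(Nat.cast_nonneg r : (0 : ℝ) ≤ r)]
    obtain ⟨A, hA0, hA⟩ := ih hw' (p := p - 1) (by linarith)
    set c : ℝ := 1 / x₀ + 1 / (w 0 * (p - 1))
    have hc0 : 0 ≤ c :=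
      add_nonneg (by positivity) (one_div_nonneg.2 (mul_pos (hw 0) (sub_pos.2 hp1)).le)
    refine ⟨c * A, by positivity, fun x hx ↦ ?_⟩
    obtain ⟨htail, htail_le⟩ := hA x hx
    have hform (m) : x₀ ≤ barnesForm (Fin.tail w) x m := hx.trans (le_barnesForm hw' x m)
    obtain ⟨hsum, hsum_le⟩ := summable_prod_of_tsum_fiber_le
      (f := fun q : (Fin r → ℕ) × ℕ ↦ barnesForm w x (finConsEquiv r q) ^ (-p))
      (g := fun m ↦ c * barnesForm (Fin.tail w) x m ^ (-(p - 1)))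
      (fun q ↦ Real.rpow_nonneg (barnesForm_pos hw (hx₀.trans_le hx) _).le _)
      (fun m ↦ by
        simpa only [barnesForm_finConsEquiv] using
          summable_rpow_add_mul (hx₀.trans_le (hform m)) (hw 0) hp1)
      (fun m ↦ by
        simpa only [barnesForm_finConsEquiv] using tsum_rpow_add_mul_le hx₀ (hform m) (hw 0) hp1)
      (htail.mul_left c)
    refine ⟨(finConsEquiv r).summable_iff.1 hsum, ?_⟩
    rw [← (finConsEquiv r).tsum_eq]
    calc _ ≤ ∑' m, c * barnesForm (Fin.tail w) x m ^ (-(p - 1)) := hsum_le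
      _ ≤ c * (A * x ^ (r - (p - 1))) := by rw [tsum_mul_left]; gcongr
      _ = c * A * x ^ ((r + 1 : ℕ) - p) := by push_cast; ring_nf

theorem norm_ofReal_cpow_neg {y : ℝ} (hy : 0 < y) (s : ℂ) : ‖(y : ℂ) ^ (-s)‖ = y ^ (-s.re) := by
  rw [Complex.norm_cpow_eq_rpow_re_of_pos hy, Complex.neg_re]

theorem continuousAt_ofReal_cpow_neg {α : Type*} [TopologicalSpace α] {f : α → ℝ} {g : α → ℂ}
    {a : α} (hf : ContinuousAt f a) (hg : ContinuousAt g a) (h : 0 < f a) :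
    ContinuousAt (fun a ↦ (f a : ℂ) ^ (-(g a))) a :=
  (Complex.continuous_ofReal.continuousAt.comp hf).cpow hg.neg (Complex.ofReal_mem_slitPlane.2 h)

theorem rpow_neg_le_max_mul {x₁ y p p' σ : ℝ} (hx : 0 < x₁) (hy : x₁ ≤ y) (h1 : p ≤ σ)
    (h2 : σ ≤ p') : y ^ (-σ) ≤ max 1 (x₁ ^ (-(p' - p))) * y ^ (-p) := by
  have hy0 := hx.trans_le hy
  rw [show -σ = -(σ - p) + -p by ring, Real.rpow_add hy0]
  refine mul_le_mul_of_nonneg_right ?_ (Real.rpow_nonneg hy0.le _)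
  rcases le_total 1 y with h | h
  · exact le_max_of_le_left (Real.rpow_le_one_of_one_le_of_nonpos h (by linarith))
  · refine le_max_of_le_right ?_
    calc y ^ (-(σ - p)) ≤ y ^ (-(p' - p)) :=
          Real.rpow_le_rpow_of_exponent_ge hy0 h (by linarith)
      _ ≤ x₁ ^ (-(p' - p)) := Real.rpow_le_rpow_of_nonpos hx hy (by linarith)

/-- The Barnes multiple zeta series `∑_m (x + m₁ w₁ + ⋯ + m_r w_r)^{-s}` as a function of the
exponent and of the shift `x`. It converges for `r < re s`; elsewhere the value is junk. -/
noncomputable def barnesSeries {r : ℕ} (w : Fin r → ℝ) (s : ℂ) (x : ℝ) : ℂ :=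
  ∑' m : Fin r → ℕ, (barnesForm w x m : ℂ) ^ (-s)

section BarnesSeries

variable {r : ℕ} {w : Fin r → ℝ} {s : ℂ} {x : ℝ}

theorem summable_rpow_barnesForm (hw : ∀ j, 0 < w j) {p : ℝ} (hp : r < p) (hx : 0 < x) :
    Summable (fun m ↦ barnesForm w x m ^ (-p)) :=
  let ⟨_, _, hA⟩ := exists_summable_rpow_barnesForm_and_tsum_le hw hp hx
  (hA x le_rfl).1

theorem norm_cpow_barnesForm_le (hw : ∀ j, 0 < w j) {x₁ p p' : ℝ} (hp : 0 ≤ p) (hx₁ : 0 < x₁)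
    (hx : x₁ ≤ x) (h1 : p ≤ s.re) (h2 : s.re ≤ p') (m : Fin r → ℕ) :
    ‖(barnesForm w x m : ℂ) ^ (-s)‖ ≤ max 1 (x₁ ^ (-(p' - p))) * barnesForm w x₁ m ^ (-p) := by
  have hle : barnesForm w x₁ m ≤ barnesForm w x m := by simp only [barnesForm]; linarith
  rw [norm_ofReal_cpow_neg (barnesForm_pos hw (hx₁.trans_le hx) m)]
  exact (Real.rpow_le_rpow_of_nonpos (barnesForm_pos hw hx₁ m) hle (by linarith)).trans
    (rpow_neg_le_max_mul hx₁ (le_barnesForm hw x₁ m) h1 h2)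

theorem hasSum_barnesSeries (hw : ∀ j, 0 < w j) (hs : r < s.re) (hx : 0 < x) :
    HasSum (fun m : Fin r → ℕ ↦ (barnesForm w x m : ℂ) ^ (-s)) (barnesSeries w s x) := by
  refine (Summable.of_norm ?_).hasSum
  simpa only [norm_ofReal_cpow_neg (barnesForm_pos hw hx _)] using summable_rpow_barnesForm hw hs hx

theorem continuousOn_barnesSeries (hw : ∀ j, 0 < w j) :
    ContinuousOn (fun q : ℂ × ℝ ↦ barnesSeries w q.1 q.2) ({s | (r : ℝ) < s.re} ×ˢ Ioi 0) := by
  rintro ⟨s₀, x₀⟩ ⟨hs₀ : (r : ℝ) < s₀.re, hx₀ : 0 < x₀⟩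
  obtain ⟨p, hrp, hp⟩ := exists_between hs₀
  have hp0 : 0 ≤ p := r.cast_nonneg.trans hrp.le
  have hU : {s : ℂ | p < s.re ∧ s.re < s₀.re + 1} ×ˢ Ioi (x₀ / 2) ∈ 𝓝 (s₀, x₀) :=
    (((isOpen_lt continuous_const Complex.continuous_re).inter
      (isOpen_lt Complex.continuous_re continuous_const)).prod isOpen_Ioi).mem_nhds
      ⟨⟨hp, lt_add_one s₀.re⟩, half_lt_self hx₀⟩
  refine (ContinuousOn.continuousAt ?_ hU).continuousWithinAt
  refine continuousOn_tsum (fun m q hq ↦ ContinuousAt.continuousWithinAt ?_)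
    ((summable_rpow_barnesForm hw hrp (half_pos hx₀)).mul_left _)
    (fun m q hq ↦ norm_cpow_barnesForm_le hw hp0 (half_pos hx₀) (le_of_lt hq.2) hq.1.1.le
      hq.1.2.le m)
  refine continuousAt_ofReal_cpow_neg ?_ continuousAt_fst
    (barnesForm_pos hw ((half_pos hx₀).trans hq.2) m)
  simp only [barnesForm]
  fun_prop

theorem differentiableOn_barnesSeries (hw : ∀ j, 0 < w j) (hx : 0 < x) :
    DifferentiableOn ℂ (fun s ↦ barnesSeries w s x) {s | (r : ℝ) < s.re} := by
  intro s₀ (hs₀ : (r : ℝ) < s₀.re)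
  obtain ⟨p, hrp, hp⟩ := exists_between hs₀
  have hp0 : 0 ≤ p := r.cast_nonneg.trans hrp.le
  have hU : IsOpen {s : ℂ | p < s.re ∧ s.re < s₀.re + 1} :=
    (isOpen_lt continuous_const Complex.continuous_re).inter
      (isOpen_lt Complex.continuous_re continuous_const)
  refine (DifferentiableOn.differentiableAt ?_
    (hU.mem_nhds ⟨hp, lt_add_one s₀.re⟩)).differentiableWithinAt
  refine Complex.differentiableOn_tsum_of_summable_norm
    ((summable_rpow_barnesForm hw hrp hx).mul_left _)
    (fun m ↦ DifferentiableOn.const_cpow (by fun_prop) (Or.inl ?_)) hU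
    (fun m s hs ↦ norm_cpow_barnesForm_le hw hp0 hx le_rfl hs.1.le hs.2.le m)
  exact_mod_cast (barnesForm_pos hw hx m).ne'

end BarnesSeries

theorem hasDerivAt_ofReal_add_cpow {y u : ℝ} (h : 0 < y + u) (c : ℂ) :
    HasDerivAt (fun u : ℝ ↦ ((y + u : ℝ) : ℂ) ^ c) (c * ((y + u : ℝ) : ℂ) ^ (c - 1)) u := by
  have hadd : HasDerivAt (fun u : ℝ ↦ ((y + u : ℝ) : ℂ)) 1 u := by
    simpa using ((hasDerivAt_id u).const_add y).ofReal_comp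
  have hcpow := (hasDerivAt_id ((y + u : ℝ) : ℂ)).cpow_const (c := c)
    (Complex.ofReal_mem_slitPlane.2 h)
  simpa [Function.comp_def] using hcpow.comp u hadd

/-- The remainder, up to the factor `s (s - 1)`, in the first-order Taylor expansion of `F (s - 1)`
from `x` to `x + b`, for a family such as `F s x = x ^ (-s)` with `∂F s / ∂x = -s F (s + 1)`. -/
noncomputable def shiftIntegral (b : ℝ) (F : ℂ → ℝ → ℂ) (s : ℂ) (x : ℝ) : ℂ :=
  ∫ u in (0 : ℝ)..b, ((b - u : ℝ) : ℂ) * F (s + 1) (x + u)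

theorem cpow_sub_cpow_add_eq {y b : ℝ} (hy : 0 < y) (hyb : 0 < y + b) (s : ℂ) :
    (y : ℂ) ^ (-(s - 1)) - ((y + b : ℝ) : ℂ) ^ (-(s - 1)) =
      (s - 1) * (b * (y : ℂ) ^ (-s) -
        s * ∫ u in (0 : ℝ)..b, ((b - u : ℝ) : ℂ) * ((y + u : ℝ) : ℂ) ^ (-(s + 1))) := by
  have hpos : ∀ u ∈ uIcc 0 b, 0 < y + u := fun u hu ↦ by
    have h : min 0 b ≤ u := hu.1
    rcases min_le_iff.1 h with h | h <;> linarith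
  have hder : ∀ u ∈ uIcc 0 b, HasDerivAt
      (fun u : ℝ ↦ (s - 1) * (((b - u : ℝ) : ℂ) * ((y + u : ℝ) : ℂ) ^ (-s)) -
        ((y + u : ℝ) : ℂ) ^ (-(s - 1)))
      (-((s - 1) * s) * (((b - u : ℝ) : ℂ) * ((y + u : ℝ) : ℂ) ^ (-(s + 1)))) u := by
    intro u hu
    have hsub : HasDerivAt (fun u : ℝ ↦ ((b - u : ℝ) : ℂ)) (-1) u := by
      simpa using ((hasDerivAt_id u).const_sub b).ofReal_comp
    have hpow := hasDerivAt_ofReal_add_cpow (hpos u hu)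
    refine (((hsub.mul (hpow (-s))).const_mul (s - 1)).sub (hpow (-(s - 1)))).congr_deriv ?_
    rw [show -s - 1 = -(s + 1) by ring, show -(s - 1) - 1 = -s by ring]
    ring
  have hint : ContinuousOn (fun u : ℝ ↦ -((s - 1) * s) *
      (((b - u : ℝ) : ℂ) * ((y + u : ℝ) : ℂ) ^ (-(s + 1)))) (uIcc 0 b) :=
    continuousOn_const.mul (ContinuousOn.mul (by fun_prop) fun u hu ↦
      (hasDerivAt_ofReal_add_cpow (hpos u hu) _).continuousAt.continuousWithinAt)
  have h := intervalIntegral.integral_eq_sub_of_hasDerivAt hder hint.intervalIntegrable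
  rw [intervalIntegral.integral_const_mul] at h
  simp only [sub_self, sub_zero, add_zero, Complex.ofReal_zero, zero_mul, mul_zero, zero_sub] at h
  linear_combination -h

theorem tendsto_ofReal_add_mul_cpow_neg_atTop {y b : ℝ} (hy : 0 < y) (hb : 0 < b) {s : ℂ}
    (hs : 0 < s.re) : Tendsto (fun n : ℕ ↦ ((y + n * b : ℝ) : ℂ) ^ (-s)) atTop (𝓝 0) := by
  rw [tendsto_zero_iff_norm_tendsto_zero]
  have hpos (n : ℕ) : 0 < y + n * b := by positivity
  simp only [norm_ofReal_cpow_neg (hpos _)]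
  exact (tendsto_rpow_neg_atTop hs).comp
    (tendsto_atTop_add_const_left _ _ (tendsto_natCast_atTop_atTop.atTop_mul_const hb))

theorem hasSum_sub_succ {E : Type*} [AddCommGroup E] [TopologicalSpace E] [IsTopologicalAddGroup E]
    [T2Space E] {f : ℕ → E} (hf : Tendsto f atTop (𝓝 0))
    (hsum : Summable fun n ↦ f n - f (n + 1)) : HasSum (fun n ↦ f n - f (n + 1)) (f 0) := by
  rw [hsum.hasSum_iff_tendsto_nat]
  simpa only [Finset.sum_range_sub', sub_zero] using hf.const_sub (f 0)

section BarnesSeries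

variable {r : ℕ} {s : ℂ} {x : ℝ}

theorem hasSum_integral_barnesSeries {w : Fin r → ℝ} {b : ℝ} (hw : ∀ j, 0 < w j)
    (hs : r < s.re) (hx : 0 < x) (hb : 0 ≤ b) :
    HasSum (fun m : Fin r → ℕ ↦ ∫ u in (0 : ℝ)..b, ((b - u : ℝ) : ℂ) *
        ((barnesForm w x m + u : ℝ) : ℂ) ^ (-s))
      (∫ u in (0 : ℝ)..b, ((b - u : ℝ) : ℂ) * barnesSeries w s (x + u)) := by
  have hmem : ∀ u ∈ uIoc 0 b, 0 < u ∧ u ≤ b := fun u hu ↦ by rwa [uIoc_of_le hb] at hu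
  have hpos : ∀ m, ∀ u ∈ uIoc 0 b, 0 < barnesForm w x m + u := fun m u hu ↦
    add_pos (barnesForm_pos hw hx m) (hmem u hu).1
  have hs0 : -s.re ≤ 0 := neg_nonpos.2 (r.cast_nonneg.trans hs.le)
  refine intervalIntegral.hasSum_integral_of_dominated_convergence
    (fun m _ ↦ b * barnesForm w x m ^ (-s.re)) (fun m ↦ ?_)
    (fun m ↦ Eventually.of_forall fun u hu ↦ ?_)
    (Eventually.of_forall fun _ _ ↦ (summable_rpow_barnesForm hw hs hx).mul_left b)
    intervalIntegrable_const (Eventually.of_forall fun u hu ↦ ?_)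
  · refine ContinuousOn.aestronglyMeasurable (fun u hu ↦ ?_) measurableSet_uIoc
    exact (ContinuousAt.mul (by fun_prop) (continuousAt_ofReal_cpow_neg (by fun_prop)
      continuousAt_const (hpos m u hu))).continuousWithinAt
  · obtain ⟨hu0, hub⟩ := hmem u hu
    rw [norm_mul, norm_ofReal_cpow_neg (hpos m u hu), Complex.norm_real,
      Real.norm_of_nonneg (sub_nonneg.2 hub)]
    exact mul_le_mul (sub_le_self _ hu0.le)
      (Real.rpow_le_rpow_of_nonpos (barnesForm_pos hw hx m) (by linarith) hs0)
      (Real.rpow_nonneg (hpos m u hu).le _) hb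
  · have h := hasSum_barnesSeries hw hs (add_pos hx (hmem u hu).1)
    simp only [barnesForm_add] at h
    exact h.mul_left _

variable {w : Fin (r + 1) → ℝ}

theorem barnesSeries_tail_eq_of_hasSum (hw : ∀ j, 0 < w j) {T : ℂ} (hs : r < s.re) (hx : 0 < x)
    (hT : HasSum (fun m : Fin (r + 1) → ℕ ↦ (barnesForm w x m : ℂ) ^ (-s) -
      ((barnesForm w x m + w 0 : ℝ) : ℂ) ^ (-s)) T) :
    barnesSeries (Fin.tail w) s x = T := by
  have hw' (j) : 0 < Fin.tail w j := hw j.succ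
  have hs0 : 0 < s.re := r.cast_nonneg.trans_lt hs
  have hT' := (finConsEquiv r).hasSum_iff.2 hT
  refine (hasSum_barnesSeries hw' hs hx).unique (hT'.prod_fiberwise fun m ↦ ?_)
  have hfiber : (fun n : ℕ ↦ ((fun m ↦ (barnesForm w x m : ℂ) ^ (-s) -
      ((barnesForm w x m + w 0 : ℝ) : ℂ) ^ (-s)) ∘ finConsEquiv r) (m, n)) =
      fun n : ℕ ↦ ((barnesForm (Fin.tail w) x m + n * w 0 : ℝ) : ℂ) ^ (-s) -
        ((barnesForm (Fin.tail w) x m + (n + 1 : ℕ) * w 0 : ℝ) : ℂ) ^ (-s) := by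
    funext n
    simp only [Function.comp_apply, barnesForm_finConsEquiv]
    push_cast
    ring_nf
  have hsum := hT'.summable.prod_factor m
  rw [hfiber] at hsum ⊢
  simpa only [Nat.cast_zero, zero_mul, add_zero] using hasSum_sub_succ
    (tendsto_ofReal_add_mul_cpow_neg_atTop (barnesForm_pos hw' hx m) (hw 0) hs0) hsum

theorem barnesSeries_recursion (hw : ∀ j, 0 < w j) (hs : r + 1 < s.re) (hx : 0 < x) :
    barnesSeries (Fin.tail w) (s - 1) x = (s - 1) * (w 0 * barnesSeries w s x -
      s * shiftIntegral (w 0) (barnesSeries w) s x) := by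
  refine barnesSeries_tail_eq_of_hasSum hw (by rw [Complex.sub_re, Complex.one_re]; linarith) hx ?_
  simp only [cpow_sub_cpow_add_eq (barnesForm_pos hw hx _)
    (add_pos (barnesForm_pos hw hx _) (hw 0))]
  refine HasSum.mul_left _ (HasSum.sub (HasSum.mul_left _ ?_) (HasSum.mul_left _ ?_))
  · exact hasSum_barnesSeries hw (by push_cast; linarith) hx
  · refine hasSum_integral_barnesSeries hw ?_ hx (hw 0).le
    rw [Complex.add_re, Complex.one_re]; push_cast; linarith

theorem barnesSeries_sub_shift (hw : ∀ j, 0 < w j) (hs : r + 1 < s.re) (hx : 0 < x) :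
    barnesSeries (Fin.tail w) s x = barnesSeries w s x - barnesSeries w s (x + w 0) := by
  have hs' : ((r + 1 : ℕ) : ℝ) < s.re := by push_cast; linarith
  refine barnesSeries_tail_eq_of_hasSum hw (by linarith) hx ((hasSum_barnesSeries hw hs' hx).sub ?_)
  simpa only [barnesForm_add] using hasSum_barnesSeries hw hs' (add_pos hx (hw 0))

end BarnesSeries

/-- A family of functions `F · x`, `x > 0`, holomorphic on `V` and jointly continuous in both
variables. -/
structure IsHolomorphicFamilyOn (F : ℂ → ℝ → ℂ) (V : Set ℂ) : Prop where
  continuousOn : ContinuousOn (fun q : ℂ × ℝ ↦ F q.1 q.2) (V ×ˢ Ioi 0)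
  differentiableOn : ∀ x, 0 < x → DifferentiableOn ℂ (fun s ↦ F s x) V

namespace IsHolomorphicFamilyOn

variable {F G : ℂ → ℝ → ℂ} {U V : Set ℂ}

theorem add (hF : IsHolomorphicFamilyOn F V) (hG : IsHolomorphicFamilyOn G V) :
    IsHolomorphicFamilyOn (fun s x ↦ F s x + G s x) V where
  continuousOn := hF.continuousOn.add hG.continuousOn
  differentiableOn x hx := (hF.differentiableOn x hx).add (hG.differentiableOn x hx)

theorem mul_left {g : ℂ → ℂ} (hg : Differentiable ℂ g) (hF : IsHolomorphicFamilyOn F V) :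
    IsHolomorphicFamilyOn (fun s x ↦ g s * F s x) V where
  continuousOn := (hg.continuous.comp continuous_fst).continuousOn.mul hF.continuousOn
  differentiableOn x hx := hg.differentiableOn.mul (hF.differentiableOn x hx)

theorem comp_left {g : ℂ → ℂ} (hg : Differentiable ℂ g) (hF : IsHolomorphicFamilyOn F V)
    (hUV : MapsTo g U V) : IsHolomorphicFamilyOn (fun s x ↦ F (g s) x) U where
  continuousOn := hF.continuousOn.comp (f := fun q : ℂ × ℝ ↦ (g q.1, q.2))
    ((hg.continuous.comp continuous_fst).prodMk continuous_snd).continuousOn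
    fun _ hq ↦ ⟨hUV hq.1, hq.2⟩
  differentiableOn x hx := (hF.differentiableOn x hx).comp hg.differentiableOn hUV

theorem shiftIntegral {b : ℝ} (hb : 0 ≤ b) (hU : IsOpen U) (hF : IsHolomorphicFamilyOn F V)
    (hUV : MapsTo (· + 1) U V) : IsHolomorphicFamilyOn (shiftIntegral b F) U := by
  have hpos : ∀ x : ℝ, 0 < x → ∀ u ∈ uIcc 0 b, 0 < x + u := fun x hx u hu ↦
    add_pos_of_pos_of_nonneg hx (uIcc_of_le hb ▸ hu).1
  have hcont : ContinuousOn (fun p : (ℂ × ℝ) × ℝ ↦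
      ((b - p.2 : ℝ) : ℂ) * F (p.1.1 + 1) (p.1.2 + p.2)) ((U ×ˢ Ioi 0) ×ˢ uIcc 0 b) :=
    ContinuousOn.mul (by fun_prop) (hF.continuousOn.comp
      (f := fun p : (ℂ × ℝ) × ℝ ↦ (p.1.1 + 1, p.1.2 + p.2)) (by fun_prop)
      fun p hp ↦ ⟨hUV hp.1.1, hpos _ hp.1.2 _ hp.2⟩)
  refine ⟨continuousOn_intervalIntegral_of_continuousOn (X := ℂ × ℝ)
    (f := fun q u ↦ ((b - u : ℝ) : ℂ) * F (q.1 + 1) (q.2 + u)) hcont, fun x hx ↦ ?_⟩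
  refine differentiableOn_intervalIntegral_of_continuousOn hU ?_ fun u hu ↦ ?_
  · exact hcont.comp (f := fun p : ℂ × ℝ ↦ ((p.1, x), p.2)) (by fun_prop)
      fun p hp ↦ ⟨⟨hp.1, hx⟩, hp.2⟩
  · exact ((hF.differentiableOn _ (hpos x hx u hu)).comp (by fun_prop) hUV).const_mul _

theorem of_eventuallyEq {W : ℂ → Set ℂ} {G : ℂ → ℂ → ℝ → ℂ}
    (hG : ∀ s ∈ V, IsHolomorphicFamilyOn (G s) (W s)) (hW : ∀ s ∈ V, W s ∈ 𝓝 s)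
    (h : ∀ s ∈ V, ∀ z ∈ W s, ∀ x, 0 < x → F z x = G s z x) : IsHolomorphicFamilyOn F V where
  continuousOn := by
    rintro ⟨s, x⟩ ⟨hs, hx⟩
    have hmem : W s ×ˢ Ioi (0 : ℝ) ∈ 𝓝 (s, x) := prod_mem_nhds (hW s hs) (Ioi_mem_nhds hx)
    refine (((hG s hs).continuousOn.continuousAt hmem).congr ?_).continuousWithinAt
    filter_upwards [hmem] with q hq using (h s hs _ hq.1 _ hq.2).symm
  differentiableOn x hx s hs := by
    refine ((((hG s hs).differentiableOn x hx).differentiableAt (hW s hs)).congr_of_eventuallyEq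
      ?_).differentiableWithinAt
    filter_upwards [hW s hs] with z hz using h s hs z hz x hx

end IsHolomorphicFamilyOn

theorem isHolomorphicFamilyOn_barnesSeries {r : ℕ} {w : Fin r → ℝ} (hw : ∀ j, 0 < w j) :
    IsHolomorphicFamilyOn (barnesSeries w) {s | (r : ℝ) < s.re} :=
  ⟨continuousOn_barnesSeries hw, fun _ hx ↦ differentiableOn_barnesSeries hw hx⟩

theorem isOpen_setOf_lt_re (c : ℝ) : IsOpen {s : ℂ | c < s.re} :=
  isOpen_lt continuous_const Complex.continuous_re

theorem eq_of_eqOn_halfPlane {f g : ℂ → ℂ} (hf : Differentiable ℂ f) (hg : Differentiable ℂ g)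
    {c : ℝ} (h : EqOn f g {s | c < s.re}) : f = g := by
  refine AnalyticOnNhd.eq_of_eventuallyEq (z₀ := ((c + 1 : ℝ) : ℂ)) (fun z _ ↦ hf.analyticAt z)
    (fun z _ ↦ hg.analyticAt z) (h.eventuallyEq_of_mem ((isOpen_setOf_lt_re c).mem_nhds ?_))
  simp only [mem_ofPred_eq, Complex.ofReal_re, lt_add_one]

section BarnesDenom

variable {r : ℕ} {s : ℂ}

/-- The polynomial `(s - 1) ⋯ (s - r)`, which clears the poles of the Barnes zeta function. -/
def barnesDenom (r : ℕ) (s : ℂ) : ℂ := ∏ k ∈ Finset.range r, (s - (k + 1))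

theorem barnesDenom_succ (r : ℕ) (s : ℂ) :
    barnesDenom (r + 1) s = barnesDenom r s * (s - (r + 1)) :=
  Finset.prod_range_succ _ r

theorem barnesDenom_succ' (r : ℕ) (s : ℂ) :
    barnesDenom (r + 1) s = (s - 1) * barnesDenom r (s - 1) := by
  simp only [barnesDenom, Finset.prod_range_succ', Nat.cast_zero, zero_add, mul_comm _ (s - 1)]
  refine congrArg _ (Finset.prod_congr rfl fun k _ ↦ ?_)
  push_cast
  ring

theorem sub_mul_barnesDenom_succ_add_one (r : ℕ) (s : ℂ) :
    (s - (r + 1)) * barnesDenom (r + 1) (s + 1) = s * barnesDenom (r + 1) s := by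
  rw [barnesDenom_succ' r (s + 1), barnesDenom_succ, add_sub_cancel_right]
  ring

theorem differentiable_barnesDenom (r : ℕ) : Differentiable ℂ (barnesDenom r) := by
  unfold barnesDenom
  fun_prop

theorem barnesDenom_ne_zero (hs : ∀ k : ℕ, 1 ≤ k → k ≤ r → s ≠ k) : barnesDenom r s ≠ 0 := by
  refine Finset.prod_ne_zero_iff.2 fun k hk ↦ sub_ne_zero.2 ?_
  exact_mod_cast hs (k + 1) le_add_self (Finset.mem_range.1 hk)

theorem barnesDenom_ne_zero_of_lt_re (hs : r < s.re) : barnesDenom r s ≠ 0 := by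
  refine barnesDenom_ne_zero fun k _ hk h ↦ hs.not_ge ?_
  rw [h, Complex.natCast_re]
  exact_mod_cast hk

theorem barnesDenom_ne_zero_of_im (hs : s.im ≠ 0) : barnesDenom r s ≠ 0 :=
  barnesDenom_ne_zero fun k _ _ h ↦ hs (by rw [h, Complex.natCast_im])

end BarnesDenom

/-- `E s x` is the entire function `(s - 1) ⋯ (s - r) ζ_r(s, x, w)` of `s`. -/
structure IsBarnesNumerator {r : ℕ} (w : Fin r → ℝ) (E : ℂ → ℝ → ℂ) : Prop where
  isHolomorphicFamilyOn : IsHolomorphicFamilyOn E univ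
  eq_series : ∀ x, 0 < x → ∀ s : ℂ, r < s.re → E s x = barnesDenom r s * barnesSeries w s x

theorem IsBarnesNumerator.differentiable {r : ℕ} {w : Fin r → ℝ} {E : ℂ → ℝ → ℂ}
    (hE : IsBarnesNumerator w E) {x : ℝ} (hx : 0 < x) : Differentiable ℂ (fun s ↦ E s x) :=
  differentiableOn_univ.1 (hE.isHolomorphicFamilyOn.differentiableOn x hx)

section BarnesExtension

variable {r : ℕ} {w : Fin (r + 1) → ℝ} {E F : ℂ → ℝ → ℂ} {x : ℝ} {s : ℂ}

/-- The right-hand side of the recursion `barnesSeries_recursion`, solved for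
`(s - 1) ⋯ (s - (r + 1)) ζ_{r+1}(s, x, w)`, in terms of the numerator `E` for the tail of `w` and
of a candidate `F` for the numerator for `w` at `s + 1`. -/
noncomputable def numeratorStep (w : Fin (r + 1) → ℝ) (E F : ℂ → ℝ → ℂ) (s : ℂ) (x : ℝ) : ℂ :=
  (w 0 : ℂ)⁻¹ * (E (s - 1) x + (s - (r + 1)) * shiftIntegral (w 0) F s x)

/-- The extension of `(s - 1) ⋯ (s - (r + 1)) ζ_{r+1}(s, x, w)` to `r + 1 - n < re s`, by `n`
recursion steps from the series. -/
noncomputable def barnesExtension (w : Fin (r + 1) → ℝ) (E : ℂ → ℝ → ℂ) : ℕ → ℂ → ℝ → ℂ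
  | 0 => fun s x ↦ barnesDenom (r + 1) s * barnesSeries w s x
  | n + 1 => numeratorStep w E (barnesExtension w E n)

theorem isHolomorphicFamilyOn_numeratorStep {U V : Set ℂ} (hw : 0 ≤ w 0)
    (hE : IsHolomorphicFamilyOn E univ) (hF : IsHolomorphicFamilyOn F V) (hU : IsOpen U)
    (hUV : MapsTo (· + 1) U V) : IsHolomorphicFamilyOn (numeratorStep w E F) U :=
  .mul_left (differentiable_const _)
    (.add (hE.comp_left (differentiable_id.sub_const 1) (mapsTo_univ _ _))
      (.mul_left (by fun_prop) (hF.shiftIntegral hw hU hUV)))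

theorem isHolomorphicFamilyOn_barnesExtension (hw : ∀ j, 0 < w j)
    (hE : IsHolomorphicFamilyOn E univ) (n : ℕ) :
    IsHolomorphicFamilyOn (barnesExtension w E n) {s | (r : ℝ) + 1 - n < s.re} := by
  induction n with
  | zero =>
    simpa only [barnesExtension, Nat.cast_add, Nat.cast_one, Nat.cast_zero, sub_zero] using
      (isHolomorphicFamilyOn_barnesSeries hw).mul_left (differentiable_barnesDenom (r + 1))
  | succ n ih =>
    refine isHolomorphicFamilyOn_numeratorStep (hw 0).le hE ih (isOpen_setOf_lt_re _) fun s hs ↦ ?_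
    simp only [mem_ofPred_eq, Complex.add_re, Complex.one_re] at hs ⊢
    push_cast at hs
    linarith

theorem shiftIntegral_congr {b : ℝ} (hb : 0 ≤ b) (hx : 0 < x)
    (h : ∀ y, 0 < y → E (s + 1) y = F (s + 1) y) : shiftIntegral b E s x = shiftIntegral b F s x :=
  intervalIntegral.integral_congr fun u hu ↦ by
    rw [uIcc_of_le hb] at hu
    simp only [h _ (add_pos_of_pos_of_nonneg hx hu.1)]

theorem numeratorStep_eq_series (hw : ∀ j, 0 < w j) (hE : IsBarnesNumerator (Fin.tail w) E)
    (hF : ∀ y, 0 < y → ∀ z : ℂ, r + 1 < z.re →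
      F z y = barnesDenom (r + 1) z * barnesSeries w z y) (hx : 0 < x) (hs : r + 1 < s.re) :
    numeratorStep w E F s x = barnesDenom (r + 1) s * barnesSeries w s x := by
  have hw0 : (w 0 : ℂ) ≠ 0 := by exact_mod_cast (hw 0).ne'
  have hint : shiftIntegral (w 0) F s x =
      barnesDenom (r + 1) (s + 1) * shiftIntegral (w 0) (barnesSeries w) s x := by
    have hs' : r + 1 < (s + 1).re := by rw [Complex.add_re, Complex.one_re]; linarith
    rw [shiftIntegral_congr (F := fun z y ↦ barnesDenom (r + 1) z * barnesSeries w z y)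
      (hw 0).le hx fun y hy ↦ hF y hy (s + 1) hs']
    simp only [shiftIntegral, mul_left_comm _ (barnesDenom _ _),
      intervalIntegral.integral_const_mul]
  rw [numeratorStep, hint, hE.eq_series x hx _ (by rw [Complex.sub_re, Complex.one_re]; linarith),
    barnesSeries_recursion hw hs hx, inv_mul_eq_iff_eq_mul₀ hw0, ← mul_assoc (s - (r + 1)),
    sub_mul_barnesDenom_succ_add_one, barnesDenom_succ']
  ring

theorem barnesExtension_succ_eq (hw : ∀ j, 0 < w j) (hE : IsBarnesNumerator (Fin.tail w) E)
    (n : ℕ) (hx : 0 < x) (hs : (r : ℝ) + 1 - n < s.re) :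
    barnesExtension w E (n + 1) s x = barnesExtension w E n s x := by
  induction n generalizing s x with
  | zero =>
    exact numeratorStep_eq_series hw hE (fun _ _ _ _ ↦ rfl) hx (by simpa using hs)
  | succ n ih =>
    refine congrArg (fun I ↦ (w 0 : ℂ)⁻¹ * (E (s - 1) x + (s - (r + 1)) * I))
      (shiftIntegral_congr (hw 0).le hx fun y hy ↦ ih hy ?_)
    rw [Complex.add_re, Complex.one_re]
    push_cast at hs
    linarith

theorem barnesExtension_eq_of_le (hw : ∀ j, 0 < w j) (hE : IsBarnesNumerator (Fin.tail w) E)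
    {n k : ℕ} (hnk : n ≤ k) (hx : 0 < x) (hs : (r : ℝ) + 1 - n < s.re) :
    barnesExtension w E k s x = barnesExtension w E n s x := by
  induction k, hnk using Nat.le_induction with
  | base => rfl
  | succ k hk ih =>
    have hnk : (n : ℝ) ≤ k := by exact_mod_cast hk
    rw [barnesExtension_succ_eq hw hE k hx (by linarith), ih]

end BarnesExtension

/-- The entire function `(s - 1) ⋯ (s - r) ζ_r(s, x, w)`. The number of recursion steps depends on
`s`, but `barnesExtension_eq_of_le` shows that the pieces fit together. -/
noncomputable def barnesNumerator : {r : ℕ} → (Fin r → ℝ) → ℂ → ℝ → ℂ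
  | 0, _ => fun s x ↦ (x : ℂ) ^ (-s)
  | r + 1, w => fun s x ↦
      barnesExtension w (barnesNumerator (Fin.tail w)) (⌈r + 1 - s.re⌉₊ + 1) s x

section BarnesNumerator

theorem barnesNumerator_eq_barnesExtension {r : ℕ} {w : Fin (r + 1) → ℝ} (hw : ∀ j, 0 < w j)
    (hE : IsBarnesNumerator (Fin.tail w) (barnesNumerator (Fin.tail w))) {n : ℕ} {s : ℂ} {x : ℝ}
    (hs : (r : ℝ) + 1 - n < s.re) (hx : 0 < x) :
    barnesNumerator w s x = barnesExtension w (barnesNumerator (Fin.tail w)) n s x := by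
  have hceil := Nat.le_ceil ((r : ℝ) + 1 - s.re)
  rw [barnesNumerator]
  rcases le_total n (⌈(r : ℝ) + 1 - s.re⌉₊ + 1) with h | h
  · exact barnesExtension_eq_of_le hw hE h hx hs
  · exact (barnesExtension_eq_of_le hw hE h hx (by push_cast; linarith)).symm

theorem isBarnesNumerator_zero (w : Fin 0 → ℝ) :
    IsBarnesNumerator w (fun s x ↦ (x : ℂ) ^ (-s)) where
  isHolomorphicFamilyOn := {
    continuousOn := fun _ hq ↦ (continuousAt_ofReal_cpow_neg continuousAt_snd continuousAt_fst
      hq.2).continuousWithinAt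
    differentiableOn := fun x hx ↦
      .const_cpow (by fun_prop) (.inl (Complex.ofReal_ne_zero.2 hx.ne')) }
  eq_series x _ s _ := by simp [barnesDenom, barnesSeries, barnesForm]

theorem isBarnesNumerator_barnesNumerator {r : ℕ} {w : Fin r → ℝ} (hw : ∀ j, 0 < w j) :
    IsBarnesNumerator w (barnesNumerator w) := by
  induction r with
  | zero => exact isBarnesNumerator_zero w
  | succ r ih =>
    have hE := ih (w := Fin.tail w) fun j ↦ hw j.succ
    refine ⟨.of_eventuallyEq (W := fun s ↦ {z | (r : ℝ) + 1 - (⌈r + 1 - s.re⌉₊ + 1 : ℕ) < z.re})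
      (fun s _ ↦ isHolomorphicFamilyOn_barnesExtension hw hE.isHolomorphicFamilyOn _)
      (fun s _ ↦ (isOpen_setOf_lt_re _).mem_nhds ?_)
      fun s _ z hz x hx ↦ barnesNumerator_eq_barnesExtension hw hE hz hx, fun x hx s hs ↦ ?_⟩
    · have hceil := Nat.le_ceil ((r : ℝ) + 1 - s.re)
      simp only [mem_ofPred_eq]
      push_cast
      linarith
    · push_cast at hs
      exact barnesNumerator_eq_barnesExtension hw hE (n := 0) (by simpa using hs) hx

variable {r : ℕ} {w : Fin (r + 1) → ℝ} {x : ℝ}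

theorem barnesNumerator_recursion (hw : ∀ j, 0 < w j) (hx : 0 < x) (s : ℂ) :
    barnesNumerator w s x =
      numeratorStep w (barnesNumerator (Fin.tail w)) (barnesNumerator w) s x := by
  have hE := isBarnesNumerator_barnesNumerator (w := Fin.tail w) fun j ↦ hw j.succ
  have hF := isBarnesNumerator_barnesNumerator hw
  have hstep := isHolomorphicFamilyOn_numeratorStep (hw 0).le hE.isHolomorphicFamilyOn
    hF.isHolomorphicFamilyOn isOpen_univ (mapsTo_univ _ _)
  refine congrFun (eq_of_eqOn_halfPlane (c := r + 1) (hF.differentiable hx)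
    (differentiableOn_univ.1 (hstep.differentiableOn x hx)) fun z hz ↦ ?_) s
  have hF' : ∀ y, 0 < y → ∀ z : ℂ, r + 1 < z.re →
      barnesNumerator w z y = barnesDenom (r + 1) z * barnesSeries w z y :=
    fun y hy z hz ↦ hF.eq_series y hy z (by push_cast; exact hz)
  exact (hF' x hx z hz).trans (numeratorStep_eq_series hw hE hF' hx hz).symm

theorem barnesNumerator_sub_shift (hw : ∀ j, 0 < w j) (hx : 0 < x) (s : ℂ) :
    barnesNumerator w s x - barnesNumerator w s (x + w 0) =
      (s - (r + 1)) * barnesNumerator (Fin.tail w) s x := by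
  have hE := isBarnesNumerator_barnesNumerator (w := Fin.tail w) fun j ↦ hw j.succ
  have hF := isBarnesNumerator_barnesNumerator hw
  have hx' := add_pos hx (hw 0)
  refine congrFun (eq_of_eqOn_halfPlane (c := r + 1)
    (g := fun s ↦ (s - (r + 1)) * barnesNumerator (Fin.tail w) s x)
    ((hF.differentiable hx).sub (hF.differentiable hx'))
    (.mul (by fun_prop) (hE.differentiable hx)) fun z hz ↦ ?_) s
  replace hz : r + 1 < z.re := hz
  have hz' : ((r + 1 : ℕ) : ℝ) < z.re := by push_cast; exact hz
  simp only [Pi.sub_apply]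
  rw [hF.eq_series x hx z hz', hF.eq_series _ hx' z hz', hE.eq_series x hx z (by linarith),
    barnesSeries_sub_shift hw hz hx, barnesDenom_succ]
  ring

end BarnesNumerator

/-- The Barnes multiple zeta function on the whole plane, as a function of `s` and of the shift `x`.
At the poles `s = 1, …, r` the value is junk. -/
noncomputable def barnesCont {r : ℕ} (w : Fin r → ℝ) (s : ℂ) (x : ℝ) : ℂ :=
  barnesNumerator w s x / barnesDenom r s

section BarnesCont

variable {s : ℂ} {x : ℝ}

theorem barnesCont_eq_series {r : ℕ} {w : Fin r → ℝ} (hw : ∀ j, 0 < w j) (hs : r < s.re)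
    (hx : 0 < x) : barnesCont w s x = barnesSeries w s x := by
  rw [barnesCont, (isBarnesNumerator_barnesNumerator hw).eq_series x hx s hs,
    mul_div_cancel_left₀ _ (barnesDenom_ne_zero_of_lt_re hs)]

theorem barnesCont_zero (w : Fin 0 → ℝ) (s : ℂ) (x : ℝ) : barnesCont w s x = (x : ℂ) ^ (-s) := by
  simp only [barnesCont, barnesNumerator, barnesDenom, Finset.range_zero, Finset.prod_empty,
    div_one]

variable {r : ℕ} {w : Fin (r + 1) → ℝ}

theorem barnesCont_sub_shift (hw : ∀ j, 0 < w j) (hs : s.im ≠ 0) (hx : 0 < x) :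
    barnesCont w s x - barnesCont w s (x + w 0) = barnesCont (Fin.tail w) s x := by
  rw [barnesCont, barnesCont, barnesCont, ← sub_div, barnesNumerator_sub_shift hw hx,
    div_eq_div_iff (barnesDenom_ne_zero_of_im hs) (barnesDenom_ne_zero_of_im hs), barnesDenom_succ]
  ring

theorem barnesCont_recursion (hw : ∀ j, 0 < w j) (hs : s.im ≠ 0) (hx : 0 < x) :
    barnesCont w s x = (w 0 : ℂ)⁻¹ * (barnesCont (Fin.tail w) (s - 1) x / (s - 1) +
      s * shiftIntegral (w 0) (barnesCont w) s x) := by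
  have hdenom := barnesDenom_ne_zero_of_im (r := r + 1) hs
  have hdenom' := barnesDenom_ne_zero_of_im (r := r + 1) (s := s + 1) (by simpa using hs)
  have hint : shiftIntegral (w 0) (barnesCont w) s x =
      shiftIntegral (w 0) (barnesNumerator w) s x / barnesDenom (r + 1) (s + 1) := by
    simp only [shiftIntegral, barnesCont, ← mul_div_assoc, intervalIntegral.integral_div]
  rw [hint, barnesCont, barnesNumerator_recursion hw hx, numeratorStep, mul_div_assoc, add_div]
  congr 2
  · rw [barnesCont, barnesDenom_succ', div_div, mul_comm (s - 1)]
  · rw [← mul_div_assoc, div_eq_div_iff hdenom hdenom', mul_right_comm,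
      sub_mul_barnesDenom_succ_add_one]
    ring

end BarnesCont

theorem add_rpow_le_two_mul {x u p : ℝ} (hx : 0 < x) (hu : 0 ≤ u) (h : 2 * u * p ≤ x) :
    (x + u) ^ p ≤ 2 * x ^ p := by
  rcases le_total p 0 with hp | hp
  · exact (Real.rpow_le_rpow_of_nonpos hx (le_add_of_nonneg_right hu) hp).trans
      (le_mul_of_one_le_left (Real.rpow_nonneg hx.le p) one_le_two)
  have hexp : (1 + u / x) ^ p ≤ 2 :=
    calc (1 + u / x) ^ p ≤ Real.exp (u / x) ^ p := by
          gcongr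
          linarith [Real.add_one_le_exp (u / x)]
      _ = Real.exp (u / x * p) := (Real.exp_mul _ _).symm
      _ ≤ Real.exp (Real.log 2) := by
          have hup : u / x * p ≤ 1 / 2 := by rw [div_mul_eq_mul_div, div_le_iff₀ hx]; linarith
          exact Real.exp_le_exp.2 (hup.trans (by linarith [Real.log_two_gt_d9]))
      _ = 2 := Real.exp_log two_pos
  calc (x + u) ^ p = (1 + u / x) ^ p * x ^ p := by
        rw [← Real.mul_rpow (by positivity) hx.le]
        congr 1
        field_simp
    _ ≤ 2 * x ^ p := by gcongr

theorem norm_shiftIntegral_le {F : ℂ → ℝ → ℂ} {s : ℂ} {b x p H : ℝ} (hb : 0 ≤ b) (hx : 0 < x)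
    (hH : 0 ≤ H) (hbx : 2 * b * max p 0 ≤ x) (hF : ∀ y, x ≤ y → ‖F (s + 1) y‖ ≤ H * y ^ p) :
    ‖shiftIntegral b F s x‖ ≤ 2 * b ^ 2 * H * x ^ p := by
  have hbound : ∀ u ∈ uIoc 0 b,
      ‖((b - u : ℝ) : ℂ) * F (s + 1) (x + u)‖ ≤ b * (H * (2 * x ^ p)) := by
    intro u hu
    rw [uIoc_of_le hb] at hu
    have hup : 2 * u * p ≤ x := by
      nlinarith [mul_le_mul hu.2 le_rfl (le_max_right p 0) hb,
        mul_le_mul_of_nonneg_left (le_max_left p 0) hu.1.le]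
    rw [norm_mul, Complex.norm_real, Real.norm_of_nonneg (sub_nonneg.2 hu.2)]
    refine mul_le_mul (sub_le_self b hu.1.le) ?_ (norm_nonneg _) hb
    exact (hF _ (le_add_of_nonneg_right hu.1.le)).trans
      (mul_le_mul_of_nonneg_left (add_rpow_le_two_mul hx hu.1.le hup) hH)
  refine (intervalIntegral.norm_integral_le_of_norm_le_const hbound).trans_eq ?_
  rw [sub_zero, abs_of_nonneg hb]
  ring

theorem norm_barnesCont_le_of_add_one_le_re {r : ℕ} {w : Fin r → ℝ} (hw : ∀ j, 0 < w j) :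
    ∃ A : ℝ, 0 ≤ A ∧ ∀ (s : ℂ) (x : ℝ), (r : ℝ) + 1 ≤ s.re → 1 ≤ x →
      ‖barnesCont w s x‖ ≤ A * x ^ ((r : ℝ) - s.re) := by
  obtain ⟨A, hA0, hA⟩ :=
    exists_summable_rpow_barnesForm_and_tsum_le hw (lt_add_one (r : ℝ)) one_pos
  refine ⟨A, hA0, fun s x hs hx ↦ ?_⟩
  have hx0 : 0 < x := by linarith
  obtain ⟨hsum, htsum⟩ := hA x hx
  have hle : ∀ m, ‖(barnesForm w x m : ℂ) ^ (-s)‖ ≤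
      x ^ (-(s.re - (r + 1))) * barnesForm w x m ^ (-((r : ℝ) + 1)) := fun m ↦ by
    have hpos := barnesForm_pos hw hx0 m
    rw [norm_ofReal_cpow_neg hpos, show -s.re = -(s.re - (r + 1)) + -((r : ℝ) + 1) by ring,
      Real.rpow_add hpos]
    refine mul_le_mul_of_nonneg_right ?_ (Real.rpow_nonneg hpos.le _)
    exact Real.rpow_le_rpow_of_nonpos hx0 (le_barnesForm hw x m) (by linarith)
  rw [barnesCont_eq_series hw (by linarith) hx0]
  refine (tsum_of_norm_bounded (hsum.hasSum.mul_left _) hle).trans ?_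
  calc x ^ (-(s.re - (r + 1))) * ∑' m, barnesForm w x m ^ (-((r : ℝ) + 1))
      ≤ x ^ (-(s.re - (r + 1))) * (A * x ^ ((r : ℝ) - (r + 1))) := by gcongr
    _ = A * x ^ ((r : ℝ) - s.re) := by
      rw [mul_left_comm, ← Real.rpow_add hx0]
      congr 2
      ring

section LargeShift

variable {r : ℕ} {w : Fin (r + 1) → ℝ} {s : ℂ}

theorem norm_barnesCont_le_of_add_one {x C H : ℝ} (hw : ∀ j, 0 < w j) (hx : 0 < x)
    (hs : 0 < s.im) (hC : 0 ≤ C) (hH : 0 ≤ H) (hwx : 2 * w 0 * max (r - s.re) 0 ≤ x)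
    (hsx : 8 * w 0 * ‖s‖ ≤ x)
    (htail : ‖barnesCont (Fin.tail w) (s - 1) x‖ ≤ C * x ^ ((r : ℝ) - (s - 1).re))
    (hshift : ∀ y, x ≤ y → ‖barnesCont w (s + 1) y‖ ≤ H * y ^ ((r : ℝ) + 1 - (s + 1).re)) :
    ‖barnesCont w s x‖ ≤ ((w 0)⁻¹ * C / s.im + H / 4) * x ^ ((r : ℝ) + 1 - s.re) := by
  have hw0 := hw 0
  simp only [Complex.sub_re, Complex.add_re, Complex.one_re, add_sub_add_right_eq_sub,
    sub_sub_eq_add_sub] at htail hshift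
  have him : s.im ≤ ‖s - 1‖ := by simpa using Complex.im_le_norm (s - 1)
  have hdiv : ‖barnesCont (Fin.tail w) (s - 1) x / (s - 1)‖ ≤
      C * x ^ ((r : ℝ) + 1 - s.re) / s.im := by
    rw [norm_div]
    gcongr
  have hint : ‖s * shiftIntegral (w 0) (barnesCont w) s x‖ ≤
      w 0 * (H / 4 * x ^ ((r : ℝ) + 1 - s.re)) :=
    calc ‖s * shiftIntegral (w 0) (barnesCont w) s x‖
        ≤ ‖s‖ * (2 * w 0 ^ 2 * H * x ^ ((r : ℝ) - s.re)) := by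
          rw [norm_mul]
          gcongr
          exact norm_shiftIntegral_le hw0.le hx hH hwx hshift
      _ = w 0 * (H / 4 * (x ^ ((r : ℝ) - s.re) * (8 * w 0 * ‖s‖))) := by ring
      _ ≤ w 0 * (H / 4 * (x ^ ((r : ℝ) - s.re) * x)) := by gcongr
      _ = w 0 * (H / 4 * x ^ ((r : ℝ) + 1 - s.re)) := by
          rw [← Real.rpow_add_one hx.ne', sub_add_eq_add_sub]
  rw [barnesCont_recursion hw hs.ne' hx, norm_mul, norm_inv, Complex.norm_real,
    Real.norm_of_nonneg hw0.le]
  calc (w 0)⁻¹ * ‖_ + _‖ ≤ (w 0)⁻¹ * (C * x ^ ((r : ℝ) + 1 - s.re) / s.im +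
        w 0 * (H / 4 * x ^ ((r : ℝ) + 1 - s.re))) := by
        gcongr
        exact (norm_add_le _ _).trans (add_le_add hdiv hint)
    _ = ((w 0)⁻¹ * C / s.im + H / 4) * x ^ ((r : ℝ) + 1 - s.re) := by
        field_simp

variable {σ₀ C₁ X' : ℝ}

-- Moving `s` to the right `K` times until the series converges gains a factor `1 / 4` each time.
theorem norm_barnesCont_iterate (hw : ∀ j, 0 < w j) (hC₁ : 0 ≤ C₁) (hX' : 0 ≤ X')
    (htail : ∀ (s : ℂ) (x : ℝ), σ₀ - 1 ≤ s.re → 1 ≤ s.im → X' * ‖s‖ ≤ x → 0 < x →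
      ‖barnesCont (Fin.tail w) s x‖ ≤ C₁ * x ^ ((r : ℝ) - s.re)) :
    ∃ A : ℝ, 0 ≤ A ∧ ∃ X : ℝ, 1 ≤ X ∧ ∀ (K : ℕ) (s : ℂ) (x : ℝ), σ₀ ≤ s.re → 1 ≤ s.im →
      (r : ℝ) + 2 ≤ s.re + K → X * (‖s‖ + K) ≤ x →
      ‖barnesCont w s x‖ ≤ (2 * ((w 0)⁻¹ * C₁ / s.im) + A / 2 ^ K) * x ^ ((r : ℝ) + 1 - s.re) := by
  obtain ⟨A, hA0, hA⟩ := norm_barnesCont_le_of_add_one_le_re hw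
  have hw0 := hw 0
  set e : ℝ := max ((r : ℝ) - σ₀) 0
  have hwe : 0 ≤ w 0 * e := mul_nonneg hw0.le (le_max_right _ _)
  set X : ℝ := 1 + 2 * X' + 8 * w 0 + 2 * w 0 * e with hX
  refine ⟨A, hA0, X, by linarith [hX], fun K ↦ ?_⟩
  induction K with
  | zero =>
    intro s x _ ht hK hx
    simp only [Nat.cast_zero, add_zero] at hK hx
    have hx1 : 1 ≤ x := by nlinarith [Complex.im_le_norm s]
    have hseries := hA s x (by push_cast; linarith) hx1
    push_cast at hseries
    refine hseries.trans (mul_le_mul_of_nonneg_right ?_ (Real.rpow_nonneg (by linarith) _))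
    rw [pow_zero, div_one]
    exact le_add_of_nonneg_left (by positivity)
  | succ K ih =>
    intro s x hσ ht hK hx
    push_cast at hK hx
    have hs1 : 1 ≤ ‖s‖ := ht.trans (Complex.im_le_norm s)
    have hXx : X * ‖s‖ ≤ x := by nlinarith [K.cast_nonneg (α := ℝ)]
    have hx0 : 0 < x := (by nlinarith : 0 < X * ‖s‖).trans_le hXx
    have hsub : ‖s - 1‖ ≤ ‖s‖ + 1 := by simpa using norm_sub_le s 1
    have hadd : ‖s + 1‖ ≤ ‖s‖ + 1 := by simpa using norm_add_le s 1
    have hmax : w 0 * max ((r : ℝ) - s.re) 0 ≤ w 0 * e :=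
      mul_le_mul_of_nonneg_left (max_le_max_right 0 (by linarith)) hw0.le
    refine (norm_barnesCont_le_of_add_one (H := 2 * ((w 0)⁻¹ * C₁ / s.im) + A / 2 ^ K) hw hx0
      (by linarith) hC₁ (by positivity) (by nlinarith) (by nlinarith)
      (htail (s - 1) x (by simpa using hσ) (by simpa using ht) (by nlinarith) hx0)
      fun y hy ↦ ?_).trans (mul_le_mul_of_nonneg_right ?_ (Real.rpow_nonneg hx0.le _))
    · simpa only [Complex.add_im, Complex.one_im, add_zero] using
        ih (s + 1) y (by rw [Complex.add_re, Complex.one_re]; linarith) (by simpa using ht)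
          (by rw [Complex.add_re, Complex.one_re]; linarith) (by nlinarith)
    · have hB : 0 ≤ (w 0)⁻¹ * C₁ / s.im := by positivity
      have hAK : 0 ≤ A / 2 ^ K := by positivity
      rw [pow_succ, ← div_div]
      linarith

-- Taking `K` of size `s.im` in `norm_barnesCont_iterate` makes `A / 2 ^ K` negligible.
theorem norm_barnesCont_le_div_im_of_tail (hw : ∀ j, 0 < w j) (hC₁ : 0 ≤ C₁) (hX' : 0 ≤ X')
    (htail : ∀ (s : ℂ) (x : ℝ), σ₀ - 1 ≤ s.re → 1 ≤ s.im → X' * ‖s‖ ≤ x → 0 < x →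
      ‖barnesCont (Fin.tail w) s x‖ ≤ C₁ * x ^ ((r : ℝ) - s.re)) :
    ∃ C : ℝ, 0 ≤ C ∧ ∃ X : ℝ, 1 ≤ X ∧ ∀ (s : ℂ) (x : ℝ), σ₀ ≤ s.re → 1 ≤ s.im → X * ‖s‖ ≤ x →
      ‖barnesCont w s x‖ ≤ C * x ^ ((r : ℝ) + 1 - s.re) / s.im := by
  obtain ⟨A, hA0, X, hX1, h⟩ := norm_barnesCont_iterate hw hC₁ hX' htail
  have hw0 := hw 0
  set k := ⌈(r : ℝ) + 2 - σ₀⌉₊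
  refine ⟨2 * ((w 0)⁻¹ * C₁) + A, by positivity, X * (3 + k),
    by nlinarith [k.cast_nonneg (α := ℝ)], ?_⟩
  intro s x hσ ht hx
  have hs : s.im ≤ ‖s‖ := Complex.im_le_norm s
  have hx0 : 0 < x := lt_of_lt_of_le (mul_pos (by positivity) (by linarith)) hx
  have hK_ge : (r : ℝ) + 2 ≤ s.re + (⌈s.im⌉₊ + k : ℕ) := by
    push_cast
    linarith [Nat.le_ceil ((r : ℝ) + 2 - σ₀), (⌈s.im⌉₊).cast_nonneg (α := ℝ)]
  have hK_le : X * (‖s‖ + (⌈s.im⌉₊ + k : ℕ)) ≤ x := by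
    refine le_trans ?_ hx
    rw [mul_assoc]
    push_cast
    gcongr
    nlinarith [Nat.ceil_lt_add_one (zero_le_one.trans ht)]
  have him : s.im ≤ 2 ^ (⌈s.im⌉₊ + k) := by
    refine (Nat.le_ceil s.im).trans ?_
    exact_mod_cast Nat.lt_two_pow_self.le.trans
      (Nat.pow_le_pow_right two_pos (Nat.le_add_right _ k))
  refine (h (⌈s.im⌉₊ + k) s x hσ ht hK_ge hK_le).trans ?_
  rw [mul_div_right_comm (2 * ((w 0)⁻¹ * C₁) + A), add_div, mul_div_assoc 2]
  gcongr

end LargeShift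

theorem norm_barnesCont_le {r : ℕ} {w : Fin r → ℝ} (hw : ∀ j, 0 < w j) (σ₀ : ℝ) :
    ∃ C : ℝ, 0 ≤ C ∧ ∃ X : ℝ, 0 ≤ X ∧ ∀ (s : ℂ) (x : ℝ), σ₀ ≤ s.re → 1 ≤ s.im → X * ‖s‖ ≤ x →
      0 < x → ‖barnesCont w s x‖ ≤ C * x ^ ((r : ℝ) - s.re) := by
  induction r generalizing σ₀ with
  | zero =>
    refine ⟨1, zero_le_one, 0, le_rfl, fun s x _ _ _ hx ↦ ?_⟩
    rw [barnesCont_zero, norm_ofReal_cpow_neg hx, Nat.cast_zero, zero_sub, one_mul]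
  | succ r ih =>
    obtain ⟨C₁, hC₁, X', hX', htail⟩ := ih (w := Fin.tail w) (fun j ↦ hw _) (σ₀ - 1)
    obtain ⟨C, hC, X, hX, h⟩ := norm_barnesCont_le_div_im_of_tail hw hC₁ hX' htail
    refine ⟨C, hC, X, by linarith, fun s x hσ ht hx hx0 ↦ (h s x hσ ht hx).trans ?_⟩
    push_cast
    exact div_le_self (mul_nonneg hC (Real.rpow_nonneg hx0.le _)) ht

theorem norm_barnesCont_le_div_im {r : ℕ} {w : Fin (r + 1) → ℝ} (hw : ∀ j, 0 < w j) (σ₀ : ℝ) :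
    ∃ C : ℝ, 0 ≤ C ∧ ∃ X : ℝ, 1 ≤ X ∧ ∀ (s : ℂ) (x : ℝ), σ₀ ≤ s.re → 1 ≤ s.im → X * ‖s‖ ≤ x →
      ‖barnesCont w s x‖ ≤ C * x ^ ((r : ℝ) + 1 - s.re) / s.im := by
  obtain ⟨C₁, hC₁, X', hX', htail⟩ :=
    norm_barnesCont_le (w := Fin.tail w) (fun j ↦ hw _) (σ₀ - 1)
  exact norm_barnesCont_le_div_im_of_tail hw hC₁ hX' htail

/-- The part of the Barnes zeta series over the box `[0, N)^r`. -/
noncomputable def barnesBoxSum {r : ℕ} (w : Fin r → ℝ) (N : ℕ) (s : ℂ) (x : ℝ) : ℂ :=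
  ∑ m : Fin r → Fin N, (barnesForm w x (fun j ↦ (m j : ℕ)) : ℂ) ^ (-s)

theorem barnesForm_consEquiv {r N : ℕ} (w : Fin (r + 1) → ℝ) (x : ℝ) (n : Fin N)
    (m : Fin r → Fin N) :
    barnesForm w x (fun j ↦ (Fin.consEquiv (fun _ ↦ Fin N) (n, m) j : ℕ)) =
      barnesForm (Fin.tail w) x (fun j ↦ (m j : ℕ)) + (n : ℕ) * w 0 := by
  simp only [barnesForm, Fin.consEquiv_apply, Fin.sum_univ_succ, Fin.cons_zero, Fin.cons_succ,
    Fin.tail]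
  ring

theorem barnesBoxSum_succ {r : ℕ} (w : Fin (r + 1) → ℝ) (N : ℕ) (s : ℂ) (x : ℝ) :
    barnesBoxSum w N s x = ∑ m : Fin r → Fin N, ∑ n ∈ Finset.range N,
      ((barnesForm (Fin.tail w) x (fun j ↦ (m j : ℕ)) + n * w 0 : ℝ) : ℂ) ^ (-s) := by
  rw [barnesBoxSum, ← (Fin.consEquiv (fun _ ↦ Fin N)).sum_comp, Fintype.sum_prod_type,
    Finset.sum_comm]
  simp only [barnesForm_consEquiv, Finset.sum_range]

theorem barnesBoxSum_eq_sum_tail {r : ℕ} (w : Fin (r + 1) → ℝ) (N : ℕ) (s : ℂ) (x : ℝ) :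
    barnesBoxSum w N s x = ∑ n ∈ Finset.range N, barnesBoxSum (Fin.tail w) N s (x + n * w 0) := by
  rw [barnesBoxSum_succ, Finset.sum_comm]
  simp only [barnesBoxSum, barnesForm_add]

theorem exists_rpow_le {v₀ : ℝ} (h : 0 < v₀) (v₁ e₀ e₁ : ℝ) : ∃ D : ℝ, 0 ≤ D ∧
    ∀ v e : ℝ, v₀ ≤ v → v ≤ v₁ → e₀ ≤ e → e ≤ e₁ → v ^ e ≤ D := by
  have hcont : ContinuousOn (fun p : ℝ × ℝ ↦ p.1 ^ p.2) (Icc v₀ v₁ ×ˢ Icc e₀ e₁) := fun p hp ↦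
    (Real.continuousAt_rpow p (Or.inl (h.trans_le hp.1.1).ne')).continuousWithinAt
  obtain ⟨D, hD⟩ := (isCompact_Icc.prod isCompact_Icc).exists_bound_of_continuousOn hcont
  exact ⟨|D|, abs_nonneg D, fun v e h1 h2 h3 h4 ↦
    (le_abs_self _).trans ((hD (v, e) ⟨⟨h1, h2⟩, ⟨h3, h4⟩⟩).trans (le_abs_self D))⟩

theorem norm_le_mul_im {σ₀ σ₁ : ℝ} {s : ℂ} (h0 : σ₀ ≤ s.re) (h1 : s.re ≤ σ₁) (ht : 1 ≤ s.im) :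
    ‖s‖ ≤ (1 + |σ₀| + |σ₁|) * s.im := by
  have hre : |s.re| ≤ |σ₀| + |σ₁| :=
    (abs_le_max_abs_abs h0 h1).trans (max_le_add_of_nonneg (abs_nonneg _) (abs_nonneg _))
  have hnorm := Complex.norm_le_abs_re_add_abs_im s
  rw [abs_of_nonneg (zero_le_one.trans ht)] at hnorm
  nlinarith [abs_nonneg σ₀, abs_nonneg σ₁]

section BoxApproximation

variable {r : ℕ} {w : Fin (r + 1) → ℝ}

theorem barnesCont_sub_shift_nat (hw : ∀ j, 0 < w j) {s : ℂ} (hs : s.im ≠ 0) {x : ℝ} (hx : 0 < x)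
    (N : ℕ) :
    barnesCont w s x - barnesCont w s (x + N * w 0) =
      ∑ n ∈ Finset.range N, barnesCont (Fin.tail w) s (x + n * w 0) := by
  have htelescope := Finset.sum_range_sub' (fun n : ℕ ↦ barnesCont w s (x + n * w 0)) N
  simp only [Nat.cast_zero, zero_mul, add_zero] at htelescope
  rw [← htelescope]
  refine Finset.sum_congr rfl fun n _ ↦ ?_
  have hw0 := hw 0
  rw [← barnesCont_sub_shift hw hs (by positivity), add_assoc, Nat.cast_add_one, add_one_mul]

theorem barnesCont_sub_boxSum (hw : ∀ j, 0 < w j) {s : ℂ} (hs : s.im ≠ 0) {x : ℝ} (hx : 0 < x)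
    (N : ℕ) :
    barnesCont w s x - barnesBoxSum w N s x = barnesCont w s (x + N * w 0) +
      ∑ n ∈ Finset.range N, (barnesCont (Fin.tail w) s (x + n * w 0) -
        barnesBoxSum (Fin.tail w) N s (x + n * w 0)) := by
  rw [Finset.sum_sub_distrib, ← barnesBoxSum_eq_sum_tail, ← barnesCont_sub_shift_nat hw hs hx]
  ring

theorem norm_barnesCont_le_of_le_im (hw : ∀ j, 0 < w j) (σ₀ σ₁ : ℝ) :
    ∃ b : ℝ, ∀ b₀ b₁ : ℝ, b ≤ b₀ → ∃ C : ℝ, 0 ≤ C ∧ ∀ (s : ℂ) (x : ℝ),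
      σ₀ ≤ s.re → s.re ≤ σ₁ → 1 ≤ s.im → b₀ * s.im ≤ x → x ≤ b₁ * s.im →
        ‖barnesCont w s x‖ ≤ C * s.im ^ ((r : ℝ) - s.re) := by
  obtain ⟨C, hC, X, hX, hlarge⟩ := norm_barnesCont_le_div_im hw σ₀
  refine ⟨X * (1 + |σ₀| + |σ₁|), fun b₀ b₁ hb ↦ ?_⟩
  have hb₀ : 0 < b₀ := lt_of_lt_of_le (by positivity) hb
  obtain ⟨D, hD, hpow⟩ := exists_rpow_le hb₀ b₁ ((r : ℝ) + 1 - σ₁) ((r : ℝ) + 1 - σ₀)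
  refine ⟨C * D, by positivity, fun s x h0 h1 ht hx0 hx1 ↦ ?_⟩
  have him : 0 < s.im := by linarith
  have hx : 0 < x := (mul_pos hb₀ him).trans_le hx0
  have hXs : X * ‖s‖ ≤ x :=
    calc X * ‖s‖ ≤ X * ((1 + |σ₀| + |σ₁|) * s.im) := by gcongr; exact norm_le_mul_im h0 h1 ht
      _ = X * (1 + |σ₀| + |σ₁|) * s.im := by ring
      _ ≤ x := (mul_le_mul_of_nonneg_right hb him.le).trans hx0
  have hratio : (x / s.im) ^ ((r : ℝ) + 1 - s.re) ≤ D :=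
    hpow _ _ ((le_div_iff₀ him).2 hx0) ((div_le_iff₀ him).2 hx1) (by linarith) (by linarith)
  calc ‖barnesCont w s x‖ ≤ C * x ^ ((r : ℝ) + 1 - s.re) / s.im := hlarge s x h0 ht hXs
    _ = C * (x / s.im) ^ ((r : ℝ) + 1 - s.re) * s.im ^ ((r : ℝ) - s.re) := by
        rw [Real.div_rpow hx.le him.le, add_sub_right_comm, Real.rpow_add_one him.ne']
        field_simp
    _ ≤ C * D * s.im ^ ((r : ℝ) - s.re) := by gcongr

theorem norm_sum_barnesCont_tail_sub_boxSum_le {σ₀ σ₁ Y B C : ℝ} (hw : ∀ j, 0 < w j)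
    (hC : 0 ≤ C) (htail : ∀ (s : ℂ) (x : ℝ) (N : ℕ), σ₀ ≤ s.re → s.re ≤ σ₁ → 1 ≤ s.im → 0 < x →
      x ≤ (B + 2 * Y * w 0) * s.im → Y * s.im ≤ N → N ≤ 2 * Y * s.im →
        ‖barnesCont (Fin.tail w) s x - barnesBoxSum (Fin.tail w) N s x‖ ≤
          C * s.im ^ ((r : ℝ) - 1 - s.re))
    {s : ℂ} {x : ℝ} {N : ℕ} (h0 : σ₀ ≤ s.re) (h1 : s.re ≤ σ₁) (ht : 1 ≤ s.im) (hx : 0 < x)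
    (hxB : x ≤ B * s.im) (hN : Y * s.im ≤ N) (hN' : N ≤ 2 * Y * s.im) :
    ‖∑ n ∈ Finset.range N, (barnesCont (Fin.tail w) s (x + n * w 0) -
      barnesBoxSum (Fin.tail w) N s (x + n * w 0))‖ ≤ 2 * Y * C * s.im ^ ((r : ℝ) - s.re) := by
  have hw0 := hw 0
  have him : 0 < s.im := by linarith
  have hterm : ∀ n ∈ Finset.range N, ‖barnesCont (Fin.tail w) s (x + n * w 0) -
      barnesBoxSum (Fin.tail w) N s (x + n * w 0)‖ ≤ C * s.im ^ ((r : ℝ) - 1 - s.re) := by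
    intro n hn
    have hnw : (n : ℝ) * w 0 ≤ 2 * Y * s.im * w 0 := by
      gcongr
      exact (Nat.cast_le.2 (Finset.mem_range.1 hn).le).trans hN'
    exact htail s _ N h0 h1 ht (by positivity) (by linarith) hN hN'
  calc _ ≤ ∑ _n ∈ Finset.range N, C * s.im ^ ((r : ℝ) - 1 - s.re) := norm_sum_le_of_le _ hterm
    _ = N * (C * s.im ^ ((r : ℝ) - 1 - s.re)) := by
        rw [Finset.sum_const, Finset.card_range, nsmul_eq_mul]
    _ ≤ 2 * Y * s.im * (C * s.im ^ ((r : ℝ) - 1 - s.re)) := by gcongr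
    _ = 2 * Y * C * (s.im ^ ((r : ℝ) - 1 - s.re) * s.im) := by ring
    _ = 2 * Y * C * s.im ^ ((r : ℝ) - s.re) := by
        rw [← Real.rpow_add_one him.ne', sub_right_comm, sub_add_cancel]

end BoxApproximation

theorem norm_barnesCont_sub_boxSum_le {r : ℕ} {w : Fin r → ℝ} (hw : ∀ j, 0 < w j) (σ₀ σ₁ : ℝ) :
    ∃ Y₀ : ℝ, 1 ≤ Y₀ ∧ ∀ Y : ℝ, Y₀ ≤ Y → ∀ B : ℝ, ∃ C : ℝ, 0 ≤ C ∧
      ∀ (s : ℂ) (x : ℝ) (N : ℕ), σ₀ ≤ s.re → s.re ≤ σ₁ → 1 ≤ s.im → 0 < x → x ≤ B * s.im →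
        Y * s.im ≤ N → N ≤ 2 * Y * s.im →
        ‖barnesCont w s x - barnesBoxSum w N s x‖ ≤ C * s.im ^ ((r : ℝ) - 1 - s.re) := by
  induction r with
  | zero =>
    refine ⟨1, le_rfl, fun Y _ B ↦ ⟨0, le_rfl, fun s x N _ _ _ _ _ _ _ ↦ ?_⟩⟩
    simp [barnesCont_zero, barnesBoxSum, barnesForm]
  | succ r ih =>
    have hw0 := hw 0
    obtain ⟨Y₀, hY₀, hY⟩ := ih (w := Fin.tail w) (fun j ↦ hw _)
    obtain ⟨b, hfar⟩ := norm_barnesCont_le_of_le_im hw σ₀ σ₁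
    refine ⟨max Y₀ (b / w 0), hY₀.trans (le_max_left _ _), fun Y hYY B ↦ ?_⟩
    have hbY : b ≤ Y * w 0 := (div_le_iff₀ hw0).1 ((le_max_right _ _).trans hYY)
    obtain ⟨C₁, hC₁, hfar⟩ := hfar (Y * w 0) (B + 2 * Y * w 0) hbY
    obtain ⟨C₂, hC₂, htail⟩ := hY Y ((le_max_left _ _).trans hYY) (B + 2 * Y * w 0)
    have hY0 : 0 ≤ Y := by linarith [(le_max_left Y₀ (b / w 0)).trans hYY]
    refine ⟨C₁ + 2 * Y * C₂, by positivity, fun s x N h0 h1 ht hx hxB hN hN' ↦ ?_⟩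
    have hfar' : ‖barnesCont w s (x + N * w 0)‖ ≤ C₁ * s.im ^ ((r : ℝ) - s.re) :=
      hfar s _ h0 h1 ht (by nlinarith) (by nlinarith)
    rw [barnesCont_sub_boxSum hw (by linarith) hx, Nat.cast_add_one, add_sub_cancel_right, add_mul]
    exact (norm_add_le _ _).trans (add_le_add hfar'
      (norm_sum_barnesCont_tail_sub_boxSum_le hw hC₂ htail h0 h1 ht hx hxB hN hN'))

theorem norm_sum_mul_le_of_norm_partialSum_le {c v : ℕ → ℂ} {V : ℝ} (n : ℕ)
    (hV : ∀ k ≤ n + 1, ‖∑ i ∈ Finset.range k, v i‖ ≤ V) :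
    ‖∑ i ∈ Finset.range (n + 1), c i * v i‖ ≤
      V * (‖c n‖ + ∑ i ∈ Finset.range n, ‖c (i + 1) - c i‖) := by
  have habel := Finset.sum_range_by_parts c v (n + 1)
  simp only [smul_eq_mul, Nat.add_sub_cancel] at habel
  rw [habel, mul_add, Finset.mul_sum (Finset.range n) _ V]
  refine (norm_sub_le _ _).trans (add_le_add ?_ (norm_sum_le_of_le _ fun i hi ↦ ?_))
  · rw [norm_mul, mul_comm]
    exact mul_le_mul_of_nonneg_right (hV _ le_rfl) (norm_nonneg _)
  · rw [norm_mul, mul_comm]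
    have hi' : i + 1 ≤ n + 1 := by grind
    exact mul_le_mul_of_nonneg_right (hV _ hi') (norm_nonneg _)

theorem sum_range_abs_sub_le_two_mul {c : ℕ → ℝ} {K : ℝ} {n : ℕ}
    (hc : (∀ i < n, c i ≤ c (i + 1)) ∨ ∀ i < n, c (i + 1) ≤ c i) (h0 : |c 0| ≤ K)
    (hn : |c n| ≤ K) : ∑ i ∈ Finset.range n, |c (i + 1) - c i| ≤ 2 * K := by
  have habs : ∑ i ∈ Finset.range n, |c (i + 1) - c i| = |c n - c 0| := by
    rw [← Finset.sum_range_sub]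
    rcases hc with hc | hc
    · have hpos : ∀ i ∈ Finset.range n, 0 ≤ c (i + 1) - c i := fun i hi ↦
        sub_nonneg.2 (hc i (Finset.mem_range.1 hi))
      rw [Finset.abs_sum_of_nonneg hpos]
      exact Finset.sum_congr rfl fun i hi ↦ abs_of_nonneg (hpos i hi)
    · have hneg : ∀ i ∈ Finset.range n, c (i + 1) - c i ≤ 0 := fun i hi ↦
        sub_nonpos.2 (hc i (Finset.mem_range.1 hi))
      rw [abs_of_nonpos (Finset.sum_nonpos hneg), ← Finset.sum_neg_distrib]
      exact Finset.sum_congr rfl fun i hi ↦ abs_of_nonpos (hneg i hi)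
  rw [habs]
  linarith [abs_sub (c n) (c 0)]

section Cotangent

open Real

variable {φ ψ δ : ℝ}

theorem half_sub_cot_mul_one_sub_exp (h : sin (φ / 2) ≠ 0) :
    (1 / 2 - Complex.I / 2 * (cot (φ / 2) : ℝ)) * (1 - Complex.exp (-(φ * Complex.I))) = 1 := by
  have hexp : Complex.exp (-(φ * Complex.I)) =
      ((cos (φ / 2) : ℂ) - sin (φ / 2) * Complex.I) ^ 2 := by
    rw [show -((φ : ℂ) * Complex.I) = (2 : ℕ) * ((-(φ / 2) : ℝ) * Complex.I) by push_cast; ring,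
      Complex.exp_nat_mul, Complex.exp_mul_I, ← Complex.ofReal_cos, ← Complex.ofReal_sin,
      cos_neg, sin_neg, Complex.ofReal_neg, neg_mul, ← sub_eq_add_neg]
  have hpyth : (sin (φ / 2) : ℂ) ^ 2 + (cos (φ / 2) : ℂ) ^ 2 = 1 := by
    exact_mod_cast sin_sq_add_cos_sq (φ / 2)
  have hcot : (cot (φ / 2) : ℂ) * sin (φ / 2) = cos (φ / 2) := by
    rw [← Complex.ofReal_mul, cot_eq_cos_div_sin, div_mul_cancel₀ _ h]
  have hfactor : 1 - ((cos (φ / 2) : ℂ) - sin (φ / 2) * Complex.I) ^ 2 =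
      2 * sin (φ / 2) * (sin (φ / 2) + cos (φ / 2) * Complex.I) := by
    linear_combination -hpyth - (sin (φ / 2) : ℂ) ^ 2 * Complex.I_sq
  rw [hexp, hfactor]
  linear_combination hpyth - (cos (φ / 2) : ℂ) ^ 2 * Complex.I_sq -
    Complex.I * (sin (φ / 2) + cos (φ / 2) * Complex.I) * hcot

theorem div_pi_le_sin_half (hδ : 0 ≤ δ) (h1 : δ ≤ φ) (h2 : φ ≤ 2 * π - δ) :
    δ / π ≤ sin (φ / 2) := by
  wlog h : φ ≤ π generalizing φ
  · have := this (φ := 2 * π - φ) (by linarith) (by linarith) (by linarith)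
    rwa [sub_div, mul_div_cancel_left₀ _ two_ne_zero, sin_pi_sub] at this
  calc δ / π ≤ φ / π := by gcongr
    _ = 2 / π * (φ / 2) := by ring
    _ ≤ sin (φ / 2) := mul_le_sin (by linarith) (by linarith)

theorem abs_cot_half_le (hδ : 0 < δ) (h1 : δ ≤ φ) (h2 : φ ≤ 2 * π - δ) :
    |cot (φ / 2)| ≤ π / δ := by
  have hsin := div_pi_le_sin_half hδ.le h1 h2
  have hpos : 0 < δ / π := div_pos hδ pi_pos
  rw [cot_eq_cos_div_sin, abs_div, abs_of_pos (hpos.trans_le hsin), ← one_div_div δ]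
  exact div_le_div₀ zero_le_one (abs_cos_le_one _) hpos hsin

theorem cot_half_le_cot_half (hφ : 0 < φ) (hψ : ψ < 2 * π) (h : φ ≤ ψ) :
    cot (ψ / 2) ≤ cot (φ / 2) := by
  have hφsin : 0 < sin (φ / 2) := sin_pos_of_pos_of_lt_pi (by linarith) (by linarith)
  have hψsin : 0 < sin (ψ / 2) := sin_pos_of_pos_of_lt_pi (by linarith) (by linarith)
  have hsub : 0 ≤ sin (ψ / 2 - φ / 2) :=
    sin_nonneg_of_nonneg_of_le_pi (by linarith) (by linarith)
  rw [sin_sub] at hsub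
  rw [cot_eq_cos_div_sin, cot_eq_cos_div_sin, div_le_div_iff₀ hψsin hφsin]
  linarith

end Cotangent

/-- The Kusmin–Landau inequality. -/
theorem norm_sum_le_of_phase_increments {u : ℕ → ℂ} {φ : ℕ → ℝ} {δ : ℝ} (hδ : 0 < δ) (n : ℕ)
    (hu : ∀ i, ‖u i‖ ≤ 1)
    (hstep : ∀ i < n, u (i + 1) = u i * Complex.exp (-(φ i * Complex.I)))
    (hφ : ∀ i < n, δ ≤ φ i ∧ φ i ≤ 2 * Real.pi - δ)
    (hanti : ∀ i, i + 1 < n → φ (i + 1) ≤ φ i) :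
    ‖∑ i ∈ Finset.range n, u i‖ ≤ 4 * Real.pi / δ := by
  have hπ := Real.pi_pos
  rcases n with _ | n
  · rw [Finset.range_zero, Finset.sum_empty, norm_zero]
    positivity
  set c : ℕ → ℝ := fun i ↦ Real.cot (φ i / 2)
  set g : ℕ → ℂ := fun i ↦ 1 / 2 - Complex.I / 2 * (c i : ℂ) with hg
  have hc : ∀ i < n + 1, |c i| ≤ Real.pi / δ := fun i hi ↦
    abs_cot_half_le hδ (hφ i hi).1 (hφ i hi).2
  have hterm : ∀ i ∈ Finset.range (n + 1), u i = g i * (u i - u (i + 1)) := by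
    intro i hi
    obtain ⟨h1, h2⟩ := hφ i (Finset.mem_range.1 hi)
    have hsin : Real.sin (φ i / 2) ≠ 0 :=
      ((div_pos hδ hπ).trans_le (div_pi_le_sin_half hδ.le h1 h2)).ne'
    rw [hstep i (Finset.mem_range.1 hi)]
    linear_combination -(u i) * half_sub_cot_mul_one_sub_exp hsin
  have hpartial : ∀ k ≤ n + 1, ‖∑ i ∈ Finset.range k, (u i - u (i + 1))‖ ≤ 2 := fun k _ ↦ by
    rw [Finset.sum_range_sub']
    linarith [norm_sub_le (u 0) (u k), hu 0, hu k]
  have hnorm : ∀ i, ‖g (i + 1) - g i‖ = 1 / 2 * |c (i + 1) - c i| := fun i ↦ by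
    rw [show g (i + 1) - g i = -(Complex.I / 2) * ((c (i + 1) - c i : ℝ) : ℂ) by
      simp only [hg]; push_cast; ring, norm_mul, Complex.norm_real, Real.norm_eq_abs]
    simp
  have hvar : ∑ i ∈ Finset.range n, ‖g (i + 1) - g i‖ ≤ Real.pi / δ := by
    have hmono : ∀ i < n, c i ≤ c (i + 1) := fun i hi ↦
      cot_half_le_cot_half (hδ.trans_le (hφ (i + 1) (by omega)).1)
        (by linarith [(hφ i (by omega)).2]) (hanti i (by omega))
    simp only [hnorm, ← Finset.mul_sum]
    linarith [sum_range_abs_sub_le_two_mul (.inl hmono) (hc 0 (by omega)) (hc n (by omega))]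
  have hlast : ‖g n‖ ≤ Real.pi / δ := by
    have hgn : ‖g n‖ ≤ 1 / 2 + 1 / 2 * |c n| := (norm_sub_le _ _).trans (by simp)
    have hδπ : 1 ≤ Real.pi / δ := (one_le_div hδ).2 (by linarith [hφ 0 (by omega)])
    linarith [hc n (by omega)]
  rw [Finset.sum_congr rfl hterm]
  refine (norm_sum_mul_le_of_norm_partialSum_le n hpartial).trans ?_
  calc 2 * (‖g n‖ + ∑ i ∈ Finset.range n, ‖g (i + 1) - g i‖)
      ≤ 2 * (Real.pi / δ + Real.pi / δ) := by gcongr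
    _ = 4 * Real.pi / δ := by ring

theorem exists_eq_Ico_of_ordConnected (T : Finset ℕ) (hT : (T : Set ℕ).OrdConnected) :
    ∃ p n, T = Finset.Ico p (p + n) := by
  rcases T.eq_empty_or_nonempty with rfl | h
  · exact ⟨0, 0, by simp⟩
  refine ⟨T.min' h, T.max' h + 1 - T.min' h, ?_⟩
  have hle := T.min'_le_max' h
  ext j
  rw [Finset.mem_Ico]
  refine ⟨fun hj ↦ ?_, fun hj ↦ hT.out (T.min'_mem h) (T.max'_mem h) ⟨hj.1, by omega⟩⟩
  have hmin := T.min'_le j hj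
  have hmax := T.le_max' j hj
  omega

theorem card_filter_le_of_spacing {θ : ℕ → ℝ} {ℓ δ : ℝ} (hℓ : 0 < ℓ) (hδ : 0 ≤ δ) {n : ℕ}
    (hgap : ∀ i k, i ≤ k → k < n → θ k + ((k : ℝ) - i) * ℓ ≤ θ i) (b : ℝ) :
    (({i ∈ Finset.range n | b ≤ θ i ∧ θ i ≤ b + δ} : Finset ℕ).card : ℝ) ≤ δ / ℓ + 1 := by
  set T : Finset ℕ := {i ∈ Finset.range n | b ≤ θ i ∧ θ i ≤ b + δ} with hT
  rcases T.eq_empty_or_nonempty with h | h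
  · rw [h, Finset.card_empty, Nat.cast_zero]
    positivity
  have hmem : ∀ i ∈ T, i < n ∧ b ≤ θ i ∧ θ i ≤ b + δ := fun i hi ↦ by
    simpa only [hT, Finset.mem_filter, Finset.mem_range] using hi
  have hmin := hmem _ (T.min'_mem h)
  have hmax := hmem _ (T.max'_mem h)
  have hspread : (T.max' h : ℝ) - T.min' h ≤ δ / ℓ :=
    (le_div_iff₀ hℓ).2 (by linarith [hgap _ _ (T.min'_le_max' h) hmax.1])
  have hcard : T.card + T.min' h ≤ T.max' h + 1 := by
    have hsub : T ⊆ Finset.Icc (T.min' h) (T.max' h) := fun j hj ↦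
      Finset.mem_Icc.2 ⟨T.min'_le j hj, T.le_max' j hj⟩
    have hle := Finset.card_le_card hsub
    rw [Nat.card_Icc] at hle
    have := T.min'_le_max' h
    omega
  have hcard' : (T.card : ℝ) + T.min' h ≤ T.max' h + 1 := by exact_mod_cast hcard
  linarith

section SecondDerivativeTest

variable {u : ℕ → ℂ} {θ : ℕ → ℝ} {ℓ L δ : ℝ} {n : ℕ}

theorem norm_sum_filter_le_of_phase_mod (hδ : 0 < δ) (hu : ∀ i, ‖u i‖ ≤ 1)
    (hstep : ∀ i < n, u (i + 1) = u i * Complex.exp (-(θ i * Complex.I)))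
    (hanti : ∀ i k, i ≤ k → k < n → θ k ≤ θ i) (q : ℕ) :
    ‖∑ i ∈ Finset.range n with 2 * Real.pi * q + δ ≤ θ i ∧
      θ i ≤ 2 * Real.pi * q + (2 * Real.pi - δ), u i‖ ≤ 4 * Real.pi / δ := by
  set T : Finset ℕ := {i ∈ Finset.range n | 2 * Real.pi * q + δ ≤ θ i ∧
    θ i ≤ 2 * Real.pi * q + (2 * Real.pi - δ)} with hT
  have hmem : ∀ i, i ∈ T ↔ i < n ∧ 2 * Real.pi * q + δ ≤ θ i ∧
      θ i ≤ 2 * Real.pi * q + (2 * Real.pi - δ) := fun i ↦ by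
    simp only [hT, Finset.mem_filter, Finset.mem_range]
  have hconn : (T : Set ℕ).OrdConnected := ⟨fun i hi k hk j hj ↦ by
    rw [Finset.mem_coe, hmem] at hi hk ⊢
    exact ⟨hj.2.trans_lt hk.1, hk.2.1.trans (hanti j k hj.2 hk.1),
      (hanti i j hj.1 (hj.2.trans_lt hk.1)).trans hi.2.2⟩⟩
  obtain ⟨p, N, hpN⟩ := exists_eq_Ico_of_ordConnected T hconn
  have hin : ∀ i < N, p + i < n ∧ 2 * Real.pi * q + δ ≤ θ (p + i) ∧
      θ (p + i) ≤ 2 * Real.pi * q + (2 * Real.pi - δ) := fun i hi ↦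
    (hmem _).1 (by rw [hpN, Finset.mem_Ico]; omega)
  rw [hpN, Finset.sum_Ico_eq_sum_range, Nat.add_sub_cancel_left]
  refine norm_sum_le_of_phase_increments (φ := fun i ↦ θ (p + i) - 2 * Real.pi * q) hδ N
    (fun i ↦ hu _) (fun i hi ↦ ?_) (fun i hi ↦ ?_) (fun i hi ↦ ?_)
  · rw [← add_assoc, hstep _ (hin i hi).1]
    congr 1
    refine Complex.exp_eq_exp_iff_exists_int.2 ⟨-q, ?_⟩
    push_cast
    ring
  · obtain ⟨-, h1, h2⟩ := hin i hi
    exact ⟨le_sub_iff_add_le'.2 h1, sub_le_iff_le_add'.2 h2⟩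
  · exact sub_le_sub_right (hanti _ _ (by omega) (hin (i + 1) hi).1) _

theorem norm_sum_filter_phase_period_le (hℓ : 0 < ℓ) (hu : ∀ i, ‖u i‖ ≤ 1)
    (hstep : ∀ i < n, u (i + 1) = u i * Complex.exp (-(θ i * Complex.I)))
    (hgap : ∀ i k, i ≤ k → k < n → θ k + ((k : ℝ) - i) * ℓ ≤ θ i) (q : ℕ) :
    ‖∑ i ∈ Finset.range n with 2 * Real.pi * q ≤ θ i ∧ θ i < 2 * Real.pi * q + 2 * Real.pi, u i‖ ≤
      15 / √ℓ + 2 := by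
  set δ := √ℓ with hδdef
  have hδ : 0 < δ := Real.sqrt_pos.2 hℓ
  set a := 2 * Real.pi * q
  set F : Finset ℕ := {i ∈ Finset.range n | a ≤ θ i ∧ θ i < a + 2 * Real.pi}
  set P : ℕ → Prop := fun i ↦ a + δ ≤ θ i ∧ θ i ≤ a + (2 * Real.pi - δ)
  have hmid : ‖∑ i ∈ F with P i, u i‖ ≤ 4 * Real.pi / δ := by
    have hF : ({i ∈ F | P i} : Finset ℕ) = {i ∈ Finset.range n | P i} := by
      grind
    rw [hF]
    refine norm_sum_filter_le_of_phase_mod hδ hu hstep (fun i k hik hk ↦ ?_) q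
    have hik' : (0 : ℝ) ≤ (k : ℝ) - i := sub_nonneg.2 (Nat.cast_le.2 hik)
    nlinarith [hgap i k hik hk]
  have hends : ‖∑ i ∈ F with ¬ P i, u i‖ ≤ 2 * (1 / δ + 1) := by
    have hsub : ({i ∈ F | ¬ P i} : Finset ℕ) ⊆
        {i ∈ Finset.range n | a ≤ θ i ∧ θ i ≤ a + δ} ∪
        {i ∈ Finset.range n | a + (2 * Real.pi - δ) ≤ θ i ∧
          θ i ≤ a + (2 * Real.pi - δ) + δ} := by
      grind
    have hcard := (Finset.card_le_card hsub).trans (Finset.card_union_le _ _)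
    have hδℓ : δ / ℓ = 1 / δ := by rw [hδdef, Real.sqrt_div_self']
    have hlow := card_filter_le_of_spacing hℓ hδ.le hgap a
    have hhigh := card_filter_le_of_spacing hℓ hδ.le hgap (a + (2 * Real.pi - δ))
    refine (norm_sum_le_of_le _ fun i _ ↦ hu i).trans ?_
    rw [Finset.sum_const, nsmul_eq_mul, mul_one]
    rw [hδℓ] at hlow hhigh
    have := (Nat.cast_le (α := ℝ)).2 hcard
    push_cast at this
    linarith
  rw [← Finset.sum_filter_add_sum_filter_not F P]
  calc ‖_ + _‖ ≤ 4 * Real.pi / δ + 2 * (1 / δ + 1) :=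
        (norm_add_le _ _).trans (add_le_add hmid hends)
    _ = (4 * Real.pi + 2) / δ + 2 := by ring
    _ ≤ 15 / δ + 2 := by gcongr; linarith [Real.pi_lt_d2]

-- The second-derivative test, with the second differences of the phase bounded below by `ℓ`.
theorem norm_sum_le_of_phase_spacing (hℓ : 0 < ℓ) (hL : 0 ≤ L) (hu : ∀ i, ‖u i‖ ≤ 1)
    (hstep : ∀ i < n, u (i + 1) = u i * Complex.exp (-(θ i * Complex.I)))
    (hθ : ∀ i < n, 0 ≤ θ i ∧ θ i ≤ L) (hspace : ∀ i, i + 1 < n → θ (i + 1) + ℓ ≤ θ i) :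
    ‖∑ i ∈ Finset.range n, u i‖ ≤ (L + 1) * (15 / √ℓ + 2) := by
  have hπ : 0 < 2 * Real.pi := Real.two_pi_pos
  have hgap : ∀ i k, i ≤ k → k < n → θ k + ((k : ℝ) - i) * ℓ ≤ θ i := by
    intro i k hik
    induction k, hik using Nat.le_induction with
    | base => simp
    | succ k _ ih =>
      intro hk
      push_cast
      linarith [ih (by omega), hspace k hk]
  set q : ℕ → ℕ := fun i ↦ ⌊θ i / (2 * Real.pi)⌋₊
  set Q := ⌊L / (2 * Real.pi)⌋₊ + 1 with hQ
  have hmaps : ∀ i ∈ Finset.range n, q i ∈ Finset.range Q := fun i hi ↦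
    Finset.mem_range.2 (Nat.lt_succ_of_le (Nat.floor_mono
      (by gcongr; exact (hθ i (Finset.mem_range.1 hi)).2)))
  have hQL : (Q : ℝ) ≤ L + 1 := by
    rw [hQ, Nat.cast_add_one]
    gcongr
    exact (Nat.floor_le (by positivity)).trans (div_le_self hL (by linarith [Real.pi_gt_three]))
  have hfiber : ∀ k ∈ Finset.range Q, ‖∑ i ∈ Finset.range n with q i = k, u i‖ ≤
      15 / √ℓ + 2 := by
    intro k _
    convert norm_sum_filter_phase_period_le hℓ hu hstep hgap k using 3
    refine Finset.filter_congr fun i hi ↦ ?_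
    rw [Nat.floor_eq_iff (div_nonneg (hθ i (Finset.mem_range.1 hi)).1 hπ.le), le_div_iff₀ hπ,
      div_lt_iff₀ hπ, add_one_mul, mul_comm (k : ℝ)]
  rw [← Finset.sum_fiberwise_of_maps_to hmaps]
  refine (norm_sum_le_of_le _ hfiber).trans ?_
  rw [Finset.sum_const, Finset.card_range, nsmul_eq_mul]
  gcongr

end SecondDerivativeTest

theorem exists_rpow_neg_le_mul_rpow_neg (σ₀ σ₁ : ℝ) : ∃ D : ℝ, 0 ≤ D ∧ ∀ {M y σ : ℝ}, 0 < M →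
    M ≤ y → y ≤ 2 * M → σ₀ ≤ σ → σ ≤ σ₁ → y ^ (-σ) ≤ D * M ^ (-σ) := by
  obtain ⟨D, hD, hpow⟩ := exists_rpow_le one_pos 2 (-σ₁) (-σ₀)
  refine ⟨D, hD, fun {M y σ} hM h1 h2 h3 h4 ↦ ?_⟩
  have hratio := hpow (y / M) (-σ) ((one_le_div hM).2 h1) ((div_le_iff₀ hM).2 h2)
    (neg_le_neg h4) (neg_le_neg h3)
  rwa [Real.div_rpow (hM.le.trans h1) hM.le, div_le_iff₀ (Real.rpow_pos_of_pos hM _)] at hratio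

theorem log_add_sub_log_le {z h : ℝ} (hz : 0 < z) (hh : 0 ≤ h) :
    Real.log (z + h) - Real.log z ≤ h / z := by
  rw [← Real.log_div (by positivity) hz.ne', add_div, div_self hz.ne']
  exact (Real.log_le_sub_one_of_pos (by positivity)).trans_eq (add_sub_cancel_left 1 _)

theorem log_add_add_log_sub_le {z h : ℝ} (hh : 0 ≤ h) (hz : h < z) :
    Real.log (z + h) + Real.log (z - h) ≤ 2 * Real.log z - (h / z) ^ 2 := by
  have hz0 : 0 < z := hh.trans_lt hz
  have hsub : 0 < z - h := sub_pos.2 hz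
  have hquot : (z + h) * (z - h) / z ^ 2 = 1 - (h / z) ^ 2 := by field_simp; ring
  have hlog := Real.log_le_sub_one_of_pos (show 0 < (z + h) * (z - h) / z ^ 2 by positivity)
  rw [Real.log_div (by positivity) (by positivity), Real.log_mul (by positivity) hsub.ne',
    Real.log_pow, hquot] at hlog
  push_cast at hlog
  linarith

theorem ofReal_cpow_neg_eq_mul {y : ℝ} (hy : 0 < y) (s : ℂ) :
    (y : ℂ) ^ (-s) = (y ^ (-s.re) : ℝ) * (y : ℂ) ^ (-(s.im * Complex.I)) := by
  rw [Complex.ofReal_cpow hy.le, ← Complex.cpow_add _ _ (Complex.ofReal_ne_zero.2 hy.ne')]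
  conv_lhs => rw [← Complex.re_add_im s, neg_add, ← Complex.ofReal_neg]

theorem norm_ofReal_cpow_neg_mul_I {y : ℝ} (hy : 0 < y) (t : ℝ) :
    ‖(y : ℂ) ^ (-(t * Complex.I))‖ = 1 := by
  rw [norm_ofReal_cpow_neg hy, Complex.re_ofReal_mul, Complex.I_re, mul_zero, neg_zero,
    Real.rpow_zero]

theorem ofReal_cpow_neg_mul_I_eq_mul_exp {y z : ℝ} (hy : 0 < y) (hz : 0 < z) (t : ℝ) :
    (z : ℂ) ^ (-(t * Complex.I)) = (y : ℂ) ^ (-(t * Complex.I)) *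
      Complex.exp (-((t * (Real.log z - Real.log y) : ℝ) * Complex.I)) := by
  rw [Complex.cpow_def_of_ne_zero (Complex.ofReal_ne_zero.2 hz.ne'),
    Complex.cpow_def_of_ne_zero (Complex.ofReal_ne_zero.2 hy.ne'), ← Complex.exp_add,
    ← Complex.ofReal_log hz.le, ← Complex.ofReal_log hy.le]
  congr 1
  push_cast
  ring

section Progression

variable {y w M : ℝ} {n : ℕ}

theorem card_le_of_progression (hw : 0 < w) (hM : 0 ≤ M)
    (h : ∀ i < n, M ≤ y + i * w ∧ y + i * w ≤ 2 * M) : (n : ℝ) ≤ M / w + 1 := by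
  rcases n with _ | n
  · rw [Nat.cast_zero]
    positivity
  have hfirst := (h 0 n.succ_pos).1
  have hlast := (h n n.lt_succ_self).2
  rw [Nat.cast_zero, zero_mul, add_zero] at hfirst
  rw [Nat.cast_add_one, add_le_add_iff_right, le_div_iff₀ hw]
  linarith

theorem norm_sum_cpow_mul_I_progression_le {t : ℝ} (hw : 0 < w) (hM : 0 < M) (ht : 0 < t)
    (h : ∀ i < n, M ≤ y + i * w ∧ y + i * w ≤ 2 * M) :
    ‖∑ i ∈ Finset.range n, ((y + i * w : ℝ) : ℂ) ^ (-(t * Complex.I))‖ ≤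
      (t * w / M + 1) * (30 * M / (w * √t) + 2) := by
  rcases Nat.eq_zero_or_pos n with rfl | hn
  · rw [Finset.range_zero, Finset.sum_empty, norm_zero]
    positivity
  have hy : 0 < y := by
    simpa only [Nat.cast_zero, zero_mul, add_zero] using hM.trans_le (h 0 hn).1
  have hpos : ∀ i : ℕ, 0 < y + i * w := fun i ↦ by positivity
  have hsucc : ∀ i : ℕ, y + (i + 1 : ℕ) * w = y + i * w + w := fun i ↦ by push_cast; ring
  set θ : ℕ → ℝ := fun i ↦ t * (Real.log (y + (i + 1 : ℕ) * w) - Real.log (y + i * w)) with hθ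
  have hθ_mem : ∀ i < n, 0 ≤ θ i ∧ θ i ≤ t * w / M := fun i hi ↦ by
    simp only [hθ, hsucc, mul_div_assoc]
    refine ⟨mul_nonneg ht.le (sub_nonneg.2 (Real.log_le_log (hpos i) (by linarith))), ?_⟩
    gcongr
    exact (log_add_sub_log_le (hpos i) hw.le).trans
      (div_le_div_of_nonneg_left hw.le hM (h i hi).1)
  have hθ_succ : ∀ i, i + 1 < n → θ (i + 1) + t * (w / (2 * M)) ^ 2 ≤ θ i := fun i hi ↦ by
    set z := y + (i + 1 : ℕ) * w with hz
    have hprev : y + i * w = z - w := by rw [hz, hsucc]; ring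
    have hwz : w < z := sub_pos.1 (hprev ▸ hpos i)
    have hsecond : (w / (2 * M)) ^ 2 ≤ (w / z) ^ 2 := by
      gcongr
      exact (h (i + 1) hi).2
    simp only [hθ, hsucc (i + 1), ← hz, hprev]
    rw [← mul_add]
    gcongr
    linarith [log_add_add_log_sub_le hw.le hwz]
  have hsqrt : √(t * (w / (2 * M)) ^ 2) = w * √t / (2 * M) := by
    rw [Real.sqrt_mul ht.le, Real.sqrt_sq (by positivity)]
    ring
  refine (norm_sum_le_of_phase_spacing (θ := θ) (L := t * w / M)
    (u := fun i : ℕ ↦ ((y + i * w : ℝ) : ℂ) ^ (-(t * Complex.I))) (by positivity) (by positivity)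
    (fun i ↦ (norm_ofReal_cpow_neg_mul_I (hpos i) t).le)
    (fun i _ ↦ ofReal_cpow_neg_mul_I_eq_mul_exp (hpos i) (hpos (i + 1)) t)
    hθ_mem hθ_succ).trans_eq ?_
  rw [hsqrt, div_div_eq_mul_div]
  ring

end Progression

theorem norm_sum_cpow_mul_I_progression_le_sqrt {w B : ℝ} (hw : 0 < w) (hB : 0 ≤ B) :
    ∃ C : ℝ, 0 ≤ C ∧ ∀ (y M t : ℝ) (n : ℕ), 1 ≤ t → 0 < M → M ≤ B * t →
      (∀ i < n, M ≤ y + i * w ∧ y + i * w ≤ 2 * M) →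
      ‖∑ i ∈ Finset.range n, ((y + i * w : ℝ) : ℂ) ^ (-(t * Complex.I))‖ ≤ C * √t := by
  refine ⟨1 / w + 1 + (32 + 30 * B / w + 2 * w), by positivity, fun y M t n ht hM hMB h ↦ ?_⟩
  have ht0 : 0 < t := by linarith
  have hsqrt : 1 ≤ √t := Real.one_le_sqrt.2 ht
  rw [add_mul]
  rcases le_total M √t with hMt | hMt
  · have htrivial : ‖∑ i ∈ Finset.range n, ((y + i * w : ℝ) : ℂ) ^ (-(t * Complex.I))‖ ≤ n := by
      refine (norm_sum_le_of_le _ fun i hi ↦ (norm_ofReal_cpow_neg_mul_I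
        (hM.trans_le (h i (Finset.mem_range.1 hi)).1) t).le).trans_eq ?_
      rw [Finset.sum_const, Finset.card_range, nsmul_one]
    calc _ ≤ (n : ℝ) := htrivial
      _ ≤ M / w + 1 := card_le_of_progression hw hM.le h
      _ ≤ √t / w + √t := by gcongr
      _ = (1 / w + 1) * √t := by ring
      _ ≤ _ := le_add_of_nonneg_right (by positivity)
  · have hMsqrt : M / √t ≤ B * √t := by
      rwa [div_le_iff₀ (by positivity), mul_assoc, Real.mul_self_sqrt ht0.le]
    have htM : t / M ≤ √t := by
      rw [div_le_iff₀ hM]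
      nlinarith [Real.mul_self_sqrt ht0.le]
    calc _ ≤ (t * w / M + 1) * (30 * M / (w * √t) + 2) :=
          norm_sum_cpow_mul_I_progression_le hw hM ht0 h
      _ = 30 * (t / √t) + 30 / w * (M / √t) + 2 * w * (t / M) + 2 := by field_simp; ring
      _ ≤ 30 * √t + 30 / w * (B * √t) + 2 * w * √t + 2 * √t := by
          rw [Real.div_sqrt]
          gcongr
          linarith
      _ = (32 + 30 * B / w + 2 * w) * √t := by ring
      _ ≤ _ := le_add_of_nonneg_left (by positivity)

theorem norm_sum_cpow_progression_le_self {w a : ℝ} (hw : 0 < w) (ha : 0 < a) (σ₀ σ₁ : ℝ) :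
    ∃ C : ℝ, 0 ≤ C ∧ ∀ (s : ℂ) (y M : ℝ) (n : ℕ), σ₀ ≤ s.re → s.re ≤ σ₁ → a ≤ M →
      (∀ i < n, M ≤ y + i * w ∧ y + i * w ≤ 2 * M) →
      ‖∑ i ∈ Finset.range n, ((y + i * w : ℝ) : ℂ) ^ (-s)‖ ≤ C * (M ^ (-s.re) * M) := by
  obtain ⟨D, hD, hpow⟩ := exists_rpow_neg_le_mul_rpow_neg σ₀ σ₁
  refine ⟨D * (1 / w + 1 / a), by positivity, fun s y M n h0 h1 haM h ↦ ?_⟩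
  have hM : 0 < M := ha.trans_le haM
  have hterm : ∀ i ∈ Finset.range n, ‖((y + i * w : ℝ) : ℂ) ^ (-s)‖ ≤ D * M ^ (-s.re) := by
    intro i hi
    obtain ⟨hMi, hiM⟩ := h i (Finset.mem_range.1 hi)
    rw [norm_ofReal_cpow_neg (hM.trans_le hMi)]
    exact hpow hM hMi hiM h0 h1
  have hn : (n : ℝ) ≤ (1 / w + 1 / a) * M :=
    calc (n : ℝ) ≤ M / w + 1 := card_le_of_progression hw hM.le h
      _ ≤ M / w + M / a := by gcongr; exact (one_le_div ha).2 haM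
      _ = (1 / w + 1 / a) * M := by ring
  calc _ ≤ (n : ℝ) * (D * M ^ (-s.re)) := by
        refine (norm_sum_le_of_le _ hterm).trans_eq ?_
        rw [Finset.sum_const, Finset.card_range, nsmul_eq_mul]
    _ ≤ (1 / w + 1 / a) * M * (D * M ^ (-s.re)) := by gcongr
    _ = D * (1 / w + 1 / a) * (M ^ (-s.re) * M) := by ring

theorem norm_sum_cpow_progression_le_sqrt {w B : ℝ} (hw : 0 < w) (hB : 0 ≤ B) (σ₀ σ₁ : ℝ) :
    ∃ C : ℝ, 0 ≤ C ∧ ∀ (s : ℂ) (y M : ℝ) (n : ℕ), σ₀ ≤ s.re → s.re ≤ σ₁ → 1 ≤ s.im → 0 < M →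
      M ≤ B * s.im → (∀ i < n, M ≤ y + i * w ∧ y + i * w ≤ 2 * M) →
      ‖∑ i ∈ Finset.range n, ((y + i * w : ℝ) : ℂ) ^ (-s)‖ ≤ C * (M ^ (-s.re) * √s.im) := by
  obtain ⟨C, hC, hsum⟩ := norm_sum_cpow_mul_I_progression_le_sqrt hw hB
  obtain ⟨D, hD, hpow⟩ := exists_rpow_neg_le_mul_rpow_neg σ₀ σ₁
  refine ⟨3 * C * D, by positivity, fun s y M n h0 h1 ht hM hMB h ↦ ?_⟩
  rcases n with _ | n
  · rw [Finset.range_zero, Finset.sum_empty, norm_zero]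
    positivity
  have hy : 0 < y := by
    simpa only [Nat.cast_zero, zero_mul, add_zero] using hM.trans_le (h 0 n.succ_pos).1
  set c : ℕ → ℝ := fun i ↦ (y + i * w) ^ (-s.re)
  have hc : ∀ i < n + 1, |c i| ≤ D * M ^ (-s.re) := fun i hi ↦ by
    rw [abs_of_nonneg (Real.rpow_nonneg (by positivity) _)]
    exact hpow hM (h i hi).1 (h i hi).2 h0 h1
  have hcmono : (∀ i < n, c i ≤ c (i + 1)) ∨ ∀ i < n, c (i + 1) ≤ c i := by
    have hle : ∀ i : ℕ, y + i * w ≤ y + (i + 1 : ℕ) * w := fun i ↦ by gcongr; omega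
    rcases le_total 0 (-s.re) with hs | hs
    · exact .inl fun i _ ↦ Real.rpow_le_rpow (by positivity) (hle i) hs
    · exact .inr fun i _ ↦ Real.rpow_le_rpow_of_nonpos (by positivity) (hle i) hs
  have hvar := sum_range_abs_sub_le_two_mul hcmono (hc 0 n.succ_pos) (hc n n.lt_succ_self)
  have habel := norm_sum_mul_le_of_norm_partialSum_le (c := fun i ↦ (c i : ℂ))
    (v := fun i : ℕ ↦ ((y + i * w : ℝ) : ℂ) ^ (-(s.im * Complex.I))) n
    (fun k hk ↦ hsum y M s.im k ht hM hMB fun i hi ↦ h i (hi.trans_le hk))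
  simp only [← Complex.ofReal_sub, Complex.norm_real, Real.norm_eq_abs] at habel
  rw [Finset.sum_congr rfl fun i hi ↦
    ofReal_cpow_neg_eq_mul (hM.trans_le (h i (Finset.mem_range.1 hi)).1) s]
  calc _ ≤ C * √s.im * (|c n| + ∑ i ∈ Finset.range n, |c (i + 1) - c i|) := habel
    _ ≤ C * √s.im * (D * M ^ (-s.re) + 2 * (D * M ^ (-s.re))) := by
        gcongr
        exact hc n n.lt_succ_self
    _ = 3 * C * D * (M ^ (-s.re) * √s.im) := by ring

theorem norm_sum_cpow_progression_le {w B a : ℝ} (hw : 0 < w) (hB : 0 ≤ B) (ha : 0 < a)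
    (σ₀ σ₁ : ℝ) : ∃ C : ℝ, 0 ≤ C ∧ ∀ (s : ℂ) (y M : ℝ) (n : ℕ), σ₀ ≤ s.re → s.re ≤ σ₁ →
      1 ≤ s.im → a ≤ M → M ≤ B * s.im → (∀ i < n, M ≤ y + i * w ∧ y + i * w ≤ 2 * M) →
      ‖∑ i ∈ Finset.range n, ((y + i * w : ℝ) : ℂ) ^ (-s)‖ ≤ C * (M ^ (-s.re) * min M √s.im) := by
  obtain ⟨C₁, hC₁, hself⟩ := norm_sum_cpow_progression_le_self hw ha σ₀ σ₁
  obtain ⟨C₂, -, hsqrt⟩ := norm_sum_cpow_progression_le_sqrt hw hB σ₀ σ₁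
  refine ⟨max C₁ C₂, le_max_of_le_left hC₁, fun s y M n h0 h1 ht haM hMB h ↦ ?_⟩
  have hM : 0 < M := ha.trans_le haM
  rcases min_cases M √s.im with ⟨hmin, -⟩ | ⟨hmin, -⟩ <;> rw [hmin]
  · refine (hself s y M n h0 h1 haM h).trans ?_
    gcongr
    exact le_max_left _ _
  · refine (hsqrt s y M n h0 h1 ht hM hMB h).trans ?_
    gcongr
    exact le_max_right _ _

/-- The index `k` of the dyadic shell `a 2^k ≤ y < a 2^(k+1)` containing `y`, for `a ≤ y`. -/
noncomputable def dyadicIndex (a y : ℝ) : ℕ := Nat.log 2 ⌊y / a⌋₊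

theorem mul_two_pow_dyadicIndex_le {a y : ℝ} (ha : 0 < a) (hy : a ≤ y) :
    a * 2 ^ dyadicIndex a y ≤ y := by
  have h1 : 1 ≤ y / a := (one_le_div ha).2 hy
  have hpow : ((2 ^ dyadicIndex a y : ℕ) : ℝ) ≤ y / a :=
    (Nat.cast_le.2 (Nat.pow_log_le_self 2 (Nat.floor_pos.2 h1).ne')).trans
      (Nat.floor_le (zero_le_one.trans h1))
  push_cast at hpow
  exact (le_div_iff₀' ha).1 hpow

theorem le_two_mul_mul_two_pow_dyadicIndex {a : ℝ} (ha : 0 < a) (y : ℝ) :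
    y ≤ 2 * (a * 2 ^ dyadicIndex a y) := by
  have hpow : ⌊y / a⌋₊ + 1 ≤ 2 ^ (dyadicIndex a y + 1) :=
    Nat.lt_pow_succ_log_self one_lt_two _
  have hlt : y / a < ((2 ^ (dyadicIndex a y + 1) : ℕ) : ℝ) :=
    (Nat.lt_floor_add_one _).trans_le (by exact_mod_cast hpow)
  push_cast at hlt
  rw [div_lt_iff₀ ha, pow_succ] at hlt
  linarith

theorem dyadicIndex_mono {a y z : ℝ} (ha : 0 < a) (h : y ≤ z) :
    dyadicIndex a y ≤ dyadicIndex a z :=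
  Nat.log_mono_right (Nat.floor_mono (by gcongr))

theorem exists_dyadicIndex_le_log {a B : ℝ} (ha : 0 < a) (haB : a ≤ B) : ∃ C : ℝ, 0 ≤ C ∧
    ∀ t : ℝ, 2 ≤ t → (dyadicIndex a (B * t) : ℝ) + 1 ≤ C * Real.log t := by
  have hlog2 : 0 < Real.log 2 := Real.log_pos one_lt_two
  have hBa : 0 ≤ Real.log (B / a) := Real.log_nonneg ((one_le_div ha).2 haB)
  refine ⟨((Real.log (B / a) / Real.log 2 + 1) + 1) / Real.log 2, by positivity, fun t ht ↦ ?_⟩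
  have ht0 : 0 < t := by linarith
  have hB : 0 < B := ha.trans_le haB
  have hlogt : Real.log 2 ≤ Real.log t := Real.log_le_log two_pos ht
  have hpow : (2 : ℝ) ^ dyadicIndex a (B * t) ≤ B / a * t := by
    rw [div_mul_eq_mul_div, le_div_iff₀' ha]
    exact mul_two_pow_dyadicIndex_le ha (haB.trans (le_mul_of_one_le_right hB.le (by linarith)))
  have hlog := Real.log_le_log (by positivity) hpow
  rw [Real.log_pow, Real.log_mul (by positivity) ht0.ne', ← le_div_iff₀ hlog2, add_div] at hlog
  calc (dyadicIndex a (B * t) : ℝ) + 1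
      ≤ (Real.log (B / a) / Real.log 2 + 1) * 1 + Real.log t / Real.log 2 := by linarith
    _ ≤ (Real.log (B / a) / Real.log 2 + 1) * (Real.log t / Real.log 2) +
        Real.log t / Real.log 2 := by
      gcongr
      exact (one_le_div hlog2).2 hlogt
    _ = _ := by ring

theorem card_filter_fin_mul_le {w a M : ℝ} (hw : 0 < w) (ha : 0 < a) (hM : a ≤ M) (N : ℕ) :
    ((Finset.univ.filter fun n : Fin N ↦ ((n : ℕ) : ℝ) * w ≤ 2 * M).card : ℝ) ≤
      (2 / w + 1 / a) * M := by
  have hM0 : 0 < M := ha.trans_le hM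
  have hcard : (Finset.univ.filter fun n : Fin N ↦ ((n : ℕ) : ℝ) * w ≤ 2 * M).card ≤
      (Finset.range (⌊2 * M / w⌋₊ + 1)).card := by
    refine Finset.card_le_card_of_injOn (fun n ↦ (n : ℕ)) (fun n hn ↦ ?_) Fin.val_injective.injOn
    simp only [Finset.coe_filter, Finset.mem_univ, true_and, mem_ofPred_eq] at hn
    simp only [Finset.coe_range, mem_Iio, Nat.lt_succ_iff]
    exact Nat.le_floor ((le_div_iff₀ hw).2 hn)
  rw [Finset.card_range] at hcard
  calc _ ≤ (⌊2 * M / w⌋₊ : ℝ) + 1 := by exact_mod_cast hcard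
    _ ≤ 2 * M / w + M / a :=
        add_le_add (Nat.floor_le (by positivity)) ((one_le_div ha).2 hM)
    _ = _ := by ring

theorem card_filter_barnesForm_le {r : ℕ} {w : Fin r → ℝ} (hw : ∀ j, 0 < w j) {a : ℝ}
    (ha : 0 < a) : ∃ D : ℝ, 0 ≤ D ∧ ∀ (N : ℕ) (M : ℝ), a ≤ M →
      ((Finset.univ.filter fun m : Fin r → Fin N ↦
        barnesForm w a (fun j ↦ (m j : ℕ)) ≤ 2 * M).card : ℝ) ≤ D * M ^ r := by
  refine ⟨∏ j, (2 / w j + 1 / a), Finset.prod_nonneg fun j _ ↦ ?_, fun N M hM ↦ ?_⟩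
  · have := hw j
    positivity
  have hsub : (Finset.univ.filter fun m : Fin r → Fin N ↦
      barnesForm w a (fun j ↦ (m j : ℕ)) ≤ 2 * M) ⊆
      Fintype.piFinset fun j ↦ Finset.univ.filter fun n : Fin N ↦ ((n : ℕ) : ℝ) * w j ≤ 2 * M := by
    intro m hm
    rw [Fintype.mem_piFinset]
    intro j
    simp only [Finset.mem_filter, Finset.mem_univ, true_and, barnesForm] at hm ⊢
    have hj : ((m j : ℕ) : ℝ) * w j ≤ ∑ j, ((m j : ℕ) : ℝ) * w j :=
      Finset.single_le_sum (f := fun j ↦ ((m j : ℕ) : ℝ) * w j)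
        (fun i _ ↦ mul_nonneg (Nat.cast_nonneg _) (hw i).le) (Finset.mem_univ j)
    linarith
  refine (Nat.cast_le.2 (Finset.card_le_card hsub)).trans ?_
  rw [Fintype.card_piFinset, Nat.cast_prod]
  calc ∏ j, ((Finset.univ.filter fun n : Fin N ↦ ((n : ℕ) : ℝ) * w j ≤ 2 * M).card : ℝ)
      ≤ ∏ j, ((2 / w j + 1 / a) * M) :=
        Finset.prod_le_prod (fun _ _ ↦ Nat.cast_nonneg _)
          fun j _ ↦ card_filter_fin_mul_le (hw j) ha hM N
    _ = _ := by rw [Finset.prod_mul_distrib, Finset.prod_const, Finset.card_univ, Fintype.card_fin]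

theorem norm_sum_cpow_dyadic_le {w a B : ℝ} (hw : 0 < w) (ha : 0 < a) (hB : 0 ≤ B) (σ₀ σ₁ : ℝ) :
    ∃ C : ℝ, 0 ≤ C ∧ ∀ (s : ℂ) (y : ℝ) (N k : ℕ), σ₀ ≤ s.re → s.re ≤ σ₁ → 1 ≤ s.im → a ≤ y →
      a * 2 ^ k ≤ B * s.im →
      ‖∑ n ∈ Finset.range N with dyadicIndex a (y + (n : ℕ) * w) = k,
        ((y + n * w : ℝ) : ℂ) ^ (-s)‖ ≤
      if y ≤ 2 * (a * 2 ^ k) then C * ((a * 2 ^ k) ^ (-s.re) * min (a * 2 ^ k) √s.im) else 0 := by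
  obtain ⟨C, hC, hprog⟩ := norm_sum_cpow_progression_le hw hB ha σ₀ σ₁
  refine ⟨C, hC, fun s y N k h0 h1 ht hy hkB ↦ ?_⟩
  have hbounds : ∀ n : ℕ, dyadicIndex a (y + n * w) = k →
      a * 2 ^ k ≤ y + n * w ∧ y + n * w ≤ 2 * (a * 2 ^ k) := by
    rintro n rfl
    exact ⟨mul_two_pow_dyadicIndex_le ha (hy.trans (le_add_of_nonneg_right (by positivity))),
      le_two_mul_mul_two_pow_dyadicIndex ha _⟩
  split_ifs with hif
  · obtain ⟨p, n, hpn⟩ := exists_eq_Ico_of_ordConnected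
      ((Finset.range N).filter fun n : ℕ ↦ dyadicIndex a (y + n * w) = k) <| by
        refine ⟨fun i hi l hl j hj ↦ ?_⟩
        simp only [Finset.coe_filter, Finset.mem_range, mem_ofPred_eq] at hi hl ⊢
        refine ⟨hj.2.trans_lt hl.1, le_antisymm ?_ ?_⟩
        · rw [← hl.2]
          exact dyadicIndex_mono ha (by gcongr; exact hj.2)
        · rw [← hi.2]
          exact dyadicIndex_mono ha (by gcongr; exact hj.1)
    have hshift : ∀ i : ℕ, y + p * w + i * w = y + (p + i : ℕ) * w := fun i ↦ by
      push_cast; ring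
    rw [hpn, Finset.sum_Ico_eq_sum_range, Nat.add_sub_cancel_left]
    simp only [← hshift]
    refine hprog s (y + p * w) (a * 2 ^ k) n h0 h1 ht
      (le_mul_of_one_le_right ha.le (one_le_pow₀ one_le_two)) hkB fun i hi ↦ ?_
    rw [hshift]
    have hmem : p + i ∈ Finset.Ico p (p + n) := Finset.mem_Ico.2 ⟨by lia, by lia⟩
    rw [← hpn] at hmem
    exact hbounds _ (Finset.mem_filter.1 hmem).2
  · refine (norm_eq_zero.2 (Finset.sum_eq_zero fun n hn ↦ (hif ?_).elim)).le
    have hn' := (hbounds n (Finset.mem_filter.1 hn).2).2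
    exact (le_add_of_nonneg_right (by positivity)).trans hn'

theorem norm_barnesBoxSum_shell_le {r : ℕ} {w : Fin (r + 1) → ℝ} (hw : ∀ j, 0 < w j) {a B : ℝ}
    (ha : 0 < a) (hB : 0 ≤ B) (σ₀ σ₁ : ℝ) : ∃ C : ℝ, 0 ≤ C ∧ ∀ (s : ℂ) (N k : ℕ),
      σ₀ ≤ s.re → s.re ≤ σ₁ → 1 ≤ s.im → a * 2 ^ k ≤ B * s.im →
      ‖∑ m : Fin r → Fin N, ∑ n ∈ Finset.range N with
          dyadicIndex a (barnesForm (Fin.tail w) a (fun j ↦ (m j : ℕ)) + (n : ℕ) * w 0) = k,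
        ((barnesForm (Fin.tail w) a (fun j ↦ (m j : ℕ)) + n * w 0 : ℝ) : ℂ) ^ (-s)‖ ≤
      C * ((a * 2 ^ k) ^ ((r : ℝ) - s.re) * min (a * 2 ^ k) √s.im) := by
  have hw' : ∀ j, 0 < Fin.tail w j := fun j ↦ hw _
  obtain ⟨C, hC, hfiber⟩ := norm_sum_cpow_dyadic_le (hw 0) ha hB σ₀ σ₁
  obtain ⟨D, hD, hcard⟩ := card_filter_barnesForm_le hw' ha
  refine ⟨D * C, by positivity, fun s N k h0 h1 ht hkB ↦ ?_⟩
  refine (norm_sum_le_of_le _ fun m _ ↦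
    hfiber s _ N k h0 h1 ht (le_barnesForm hw' a _) hkB).trans ?_
  rw [← Finset.sum_filter, Finset.sum_const, nsmul_eq_mul]
  have hM : 0 < a * 2 ^ k := by positivity
  have hsplit : (a * 2 ^ k) ^ ((r : ℝ) - s.re) = (a * 2 ^ k) ^ r * (a * 2 ^ k) ^ (-s.re) := by
    rw [sub_eq_add_neg, Real.rpow_add hM, Real.rpow_natCast]
  calc _ ≤ D * (a * 2 ^ k) ^ r * (C * ((a * 2 ^ k) ^ (-s.re) * min (a * 2 ^ k) √s.im)) := by
        gcongr
        exact hcard N _ (le_mul_of_one_le_right ha.le (one_le_pow₀ one_le_two))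
    _ = _ := by rw [hsplit]; ring

theorem barnesForm_tail_add_le {r : ℕ} {w : Fin (r + 1) → ℝ} (hw : ∀ j, 0 ≤ w j) (a : ℝ)
    {N : ℕ} (m : Fin r → Fin N) {n : ℕ} (hn : n ≤ N) :
    barnesForm (Fin.tail w) a (fun j ↦ (m j : ℕ)) + n * w 0 ≤ a + N * ∑ j, w j := by
  have htail : ∑ j, ((m j : ℕ) : ℝ) * Fin.tail w j ≤ ∑ j, (N : ℝ) * Fin.tail w j := by
    gcongr with j
    · exact hw _
    · exact (m j).2.le
  have hhead : (n : ℝ) * w 0 ≤ N * w 0 := by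
    gcongr
    exact hw 0
  rw [barnesForm, Fin.sum_univ_succ, mul_add, Finset.mul_sum]
  linarith [show ∑ j, (N : ℝ) * Fin.tail w j = ∑ j : Fin r, (N : ℝ) * w j.succ from rfl]

theorem norm_barnesBoxSum_le {r : ℕ} {w : Fin (r + 1) → ℝ} (hw : ∀ j, 0 < w j) {a : ℝ}
    (ha : 0 < a) (σ₀ σ₁ : ℝ) {R : ℝ} (hR : 0 ≤ R) : ∃ B : ℝ, a ≤ B ∧ ∃ C : ℝ, 0 ≤ C ∧
    ∀ (s : ℂ) (N : ℕ) (G : ℝ), σ₀ ≤ s.re → s.re ≤ σ₁ → 2 ≤ s.im → N ≤ R * s.im →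
      (∀ M : ℝ, a ≤ M → M ≤ B * s.im → M ^ ((r : ℝ) - s.re) * min M √s.im ≤ G) →
      ‖barnesBoxSum w N s a‖ ≤ C * (G * Real.log s.im) := by
  have hsw : 0 ≤ ∑ j, w j := Finset.sum_nonneg fun j _ ↦ (hw j).le
  set B : ℝ := a + R * ∑ j, w j with hB
  have haB : a ≤ B := le_add_of_nonneg_right (mul_nonneg hR hsw)
  obtain ⟨C₁, hC₁, hshell⟩ := norm_barnesBoxSum_shell_le hw ha (ha.le.trans haB) σ₀ σ₁
  obtain ⟨C₂, hC₂, hlog⟩ := exists_dyadicIndex_le_log ha haB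
  refine ⟨B, haB, C₂ * C₁, by positivity, fun s N G h0 h1 ht hN hG ↦ ?_⟩
  have haBt : a ≤ B * s.im := haB.trans (le_mul_of_one_le_right (ha.le.trans haB) (by linarith))
  set K := dyadicIndex a (B * s.im) + 1 with hK
  set y : (Fin r → Fin N) → ℝ := fun m ↦ barnesForm (Fin.tail w) a (fun j ↦ (m j : ℕ))
  have hmaps : ∀ m, ∀ n ∈ Finset.range N, dyadicIndex a (y m + n * w 0) ∈ Finset.range K := by
    refine fun m n hn ↦ Finset.mem_range_succ_iff.2 (dyadicIndex_mono ha ?_)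
    calc y m + n * w 0 ≤ a * 1 + N * ∑ j, w j := by
          rw [mul_one]
          exact barnesForm_tail_add_le (fun j ↦ (hw j).le) a m (Finset.mem_range.1 hn).le
      _ ≤ a * s.im + R * s.im * ∑ j, w j := by
          gcongr
          linarith
      _ = B * s.im := by rw [hB]; ring
  have hbound : ∀ k ∈ Finset.range K, ‖∑ m, ∑ n ∈ Finset.range N with
      dyadicIndex a (y m + (n : ℕ) * w 0) = k, ((y m + n * w 0 : ℝ) : ℂ) ^ (-s)‖ ≤ C₁ * G := by
    intro k hk
    have hkB : a * 2 ^ k ≤ B * s.im := by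
      refine le_trans ?_ (mul_two_pow_dyadicIndex_le ha haBt)
      gcongr
      exacts [one_le_two, Finset.mem_range_succ_iff.1 hk]
    refine (hshell s N k h0 h1 (by linarith) hkB).trans ?_
    gcongr
    exact hG _ (le_mul_of_one_le_right ha.le (one_le_pow₀ one_le_two)) hkB
  have hG0 : 0 ≤ G := le_trans (by positivity) (hG a le_rfl haBt)
  rw [barnesBoxSum_succ, Finset.sum_congr rfl fun m _ ↦
    (Finset.sum_fiberwise_of_maps_to (hmaps m) _).symm, Finset.sum_comm]
  calc _ ≤ ∑ _k ∈ Finset.range K, C₁ * G := norm_sum_le_of_le _ hbound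
    _ = ((dyadicIndex a (B * s.im) : ℝ) + 1) * (C₁ * G) := by
        rw [Finset.sum_const, Finset.card_range, nsmul_eq_mul, hK, Nat.cast_succ]
    _ ≤ C₂ * Real.log s.im * (C₁ * G) := by
        gcongr
        exact hlog s.im ht
    _ = _ := by ring

theorem norm_barnesCont_strip_le {r : ℕ} {w : Fin (r + 1) → ℝ} (hw : ∀ j, 0 < w j) {a : ℝ}
    (ha : 0 < a) (σ₀ σ₁ : ℝ) : ∃ B : ℝ, a ≤ B ∧ ∃ C : ℝ, 0 ≤ C ∧
    ∀ (s : ℂ) (G : ℝ), σ₀ ≤ s.re → s.re ≤ σ₁ → 2 ≤ s.im →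
      (∀ M : ℝ, a ≤ M → M ≤ B * s.im → M ^ ((r : ℝ) - s.re) * min M √s.im ≤ G) →
      ‖barnesCont w s a‖ ≤ C * (s.im ^ ((r : ℝ) - s.re) + G * Real.log s.im) := by
  obtain ⟨Y, hY1, hY⟩ := norm_barnesCont_sub_boxSum_le hw σ₀ σ₁
  obtain ⟨C₁, hC₁, happrox⟩ := hY Y le_rfl a
  obtain ⟨B, hB, C₂, hC₂, hbox⟩ := norm_barnesBoxSum_le hw ha σ₀ σ₁ (R := 2 * Y) (by linarith)
  refine ⟨B, hB, C₁ + C₂, by positivity, fun s G h0 h1 ht hG ↦ ?_⟩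
  have hlog : 0 ≤ Real.log s.im := Real.log_nonneg (by linarith)
  have haBt : a ≤ B * s.im := hB.trans (le_mul_of_one_le_right (ha.le.trans hB) (by linarith))
  have hG0 : 0 ≤ G :=
    le_trans (mul_nonneg (Real.rpow_nonneg ha.le _) (le_min ha.le (Real.sqrt_nonneg _)))
      (hG a le_rfl haBt)
  have hYt : 1 ≤ Y * s.im := one_le_mul_of_one_le_of_one_le hY1 (by linarith)
  set N := ⌈Y * s.im⌉₊
  have hN : (N : ℝ) ≤ 2 * Y * s.im := by
    linarith [Nat.ceil_lt_add_one (zero_le_one.trans hYt)]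
  have hdiff := happrox s a N h0 h1 (by linarith) ha
    (le_mul_of_one_le_right ha.le (by linarith)) (Nat.le_ceil _) hN
  rw [Nat.cast_succ, add_sub_cancel_right] at hdiff
  calc ‖barnesCont w s a‖
      = ‖(barnesCont w s a - barnesBoxSum w N s a) + barnesBoxSum w N s a‖ := by
        rw [sub_add_cancel]
    _ ≤ C₁ * s.im ^ ((r : ℝ) - s.re) + C₂ * (G * Real.log s.im) :=
        norm_add_le_of_le hdiff (hbox s N G h0 h1 ht hN hG)
    _ ≤ (C₁ + C₂) * s.im ^ ((r : ℝ) - s.re) + (C₁ + C₂) * (G * Real.log s.im) := by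
        gcongr
        exacts [le_add_of_nonneg_right hC₂, le_add_of_nonneg_left hC₁]
    _ = _ := by ring

theorem exists_add_mul_log_le (D : ℝ) : ∃ C : ℝ, 0 ≤ C ∧ ∀ t P Q : ℝ, 2 ≤ t → 0 ≤ P → Q ≤ P →
    Q + D * P * Real.log t ≤ C * (P * Real.log t) := by
  have hlog2 : 0 < Real.log 2 := Real.log_pos one_lt_two
  refine ⟨1 / Real.log 2 + |D|, by positivity, fun t P Q ht hP hQ ↦ ?_⟩
  have hlog : Real.log 2 ≤ Real.log t := Real.log_le_log two_pos ht
  have hlog0 : 0 ≤ Real.log t := hlog2.le.trans hlog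
  calc Q + D * P * Real.log t ≤ P * (Real.log t / Real.log 2) + |D| * P * Real.log t := by
        gcongr
        · exact hQ.trans (le_mul_of_one_le_right hP ((one_le_div hlog2).2 hlog))
        · exact le_abs_self D
    _ = _ := by ring

theorem min_le_rpow_mul_rpow {x y θ : ℝ} (hx : 0 < x) (hy : 0 < y) (h0 : 0 ≤ θ) (h1 : θ ≤ 1) :
    min x y ≤ x ^ (1 - θ) * y ^ θ := by
  have hmin : 0 < min x y := lt_min hx hy
  calc min x y = min x y ^ (1 - θ) * min x y ^ θ := by
        rw [← Real.rpow_add hmin, sub_add_cancel, Real.rpow_one]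
    _ ≤ x ^ (1 - θ) * y ^ θ := by
        gcongr
        exacts [min_le_left _ _, min_le_right _ _]

theorem norm_barnesCont_critical_strip_le {r : ℕ} {w : Fin (r + 1) → ℝ} (hw : ∀ j, 0 < w j)
    {a : ℝ} (ha : 0 < a) : ∃ C : ℝ, ∀ s : ℂ, (r : ℝ) < s.re → s.re ≤ r + 1 → 2 ≤ s.im →
      ‖barnesCont w s a‖ ≤ C * (s.im ^ (((r : ℝ) + 1 - s.re) / 2) * Real.log s.im) := by
  obtain ⟨B, -, C, hC, hstrip⟩ := norm_barnesCont_strip_le hw ha r (r + 1)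
  obtain ⟨D, -, hlog⟩ := exists_add_mul_log_le 1
  refine ⟨C * D, fun s h0 h1 ht ↦ ?_⟩
  have ht0 : 0 < s.im := by linarith
  set θ : ℝ := (r : ℝ) + 1 - s.re with hθ
  have hG : ∀ M, a ≤ M → M ^ ((r : ℝ) - s.re) * min M √s.im ≤ s.im ^ (θ / 2) := fun M haM ↦ by
    have hM : 0 < M := ha.trans_le haM
    calc M ^ ((r : ℝ) - s.re) * min M √s.im
        ≤ M ^ ((r : ℝ) - s.re) * (M ^ (1 - θ) * √s.im ^ θ) := by
          gcongr
          exact min_le_rpow_mul_rpow hM (Real.sqrt_pos.2 ht0) (by linarith) (by linarith)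
      _ = √s.im ^ θ := by
          rw [← mul_assoc, ← Real.rpow_add hM, show (r : ℝ) - s.re + (1 - θ) = 0 by rw [hθ]; ring,
            Real.rpow_zero, one_mul]
      _ = s.im ^ (θ / 2) := (Real.rpow_div_two_eq_sqrt θ ht0.le).symm
  calc ‖barnesCont w s a‖
      ≤ C * (s.im ^ ((r : ℝ) - s.re) + 1 * s.im ^ (θ / 2) * Real.log s.im) := by
        rw [one_mul]
        exact hstrip s _ h0.le h1 ht fun M haM _ ↦ hG M haM
    _ ≤ C * (D * (s.im ^ (θ / 2) * Real.log s.im)) := by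
        gcongr
        exact hlog _ _ _ ht (by positivity)
          (Real.rpow_le_rpow_of_exponent_le (by linarith) (by linarith))
    _ = _ := (mul_assoc _ _ _).symm

theorem norm_barnesCont_left_le {r : ℕ} {w : Fin (r + 1) → ℝ} (hw : ∀ j, 0 < w j) {a : ℝ}
    (ha : 0 < a) (σ₀ : ℝ) : ∃ C : ℝ, ∀ s : ℂ, σ₀ ≤ s.re → s.re ≤ r → 2 ≤ s.im →
      ‖barnesCont w s a‖ ≤ C * (s.im ^ ((r : ℝ) + 1 - s.re - 1 / 2) * Real.log s.im) := by
  obtain ⟨B, hB, C, hC, hstrip⟩ := norm_barnesCont_strip_le hw ha σ₀ r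
  have hB0 : 0 < B := ha.trans_le hB
  obtain ⟨E, -, hpow⟩ := exists_rpow_le hB0 B 0 ((r : ℝ) - σ₀)
  obtain ⟨D, -, hlog⟩ := exists_add_mul_log_le E
  refine ⟨C * D, fun s h0 h1 ht ↦ ?_⟩
  have ht0 : 0 < s.im := by linarith
  set P : ℝ := s.im ^ ((r : ℝ) + 1 - s.re - 1 / 2) with hP
  have hG : ∀ M, a ≤ M → M ≤ B * s.im → M ^ ((r : ℝ) - s.re) * min M √s.im ≤ E * P := by
    intro M haM hMB
    have hM : 0 < M := ha.trans_le haM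
    calc M ^ ((r : ℝ) - s.re) * min M √s.im
        ≤ (B * s.im) ^ ((r : ℝ) - s.re) * √s.im := by
          gcongr
          exacts [min_le_right _ _]
      _ = B ^ ((r : ℝ) - s.re) * P := by
          rw [Real.mul_rpow hB0.le ht0.le, Real.sqrt_eq_rpow, mul_assoc, ← Real.rpow_add ht0, hP]
          congr 2
          ring
      _ ≤ E * P := by
          gcongr
          exact hpow _ _ le_rfl le_rfl (by linarith) (by linarith)
  calc ‖barnesCont w s a‖ ≤ C * (s.im ^ ((r : ℝ) - s.re) + E * P * Real.log s.im) :=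
        hstrip s _ h0 h1 ht hG
    _ ≤ C * (D * (P * Real.log s.im)) := by
        gcongr
        exact hlog _ _ _ ht (by positivity)
          (Real.rpow_le_rpow_of_exponent_le (by linarith) (by linarith))
    _ = _ := (mul_assoc _ _ _).symm

theorem norm_barnesCont_right_le {r : ℕ} {w : Fin r → ℝ} (hw : ∀ j, 0 < w j) {a : ℝ}
    (ha : 0 < a) {σ₀ : ℝ} (h : (r : ℝ) < σ₀) (σ₁ : ℝ) :
    ∃ C : ℝ, ∀ s : ℂ, σ₀ ≤ s.re → s.re ≤ σ₁ → ‖barnesCont w s a‖ ≤ C := by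
  have hσ₀ : 0 ≤ σ₀ := r.cast_nonneg.trans h.le
  refine ⟨∑' m, max 1 (a ^ (-(σ₁ - σ₀))) * barnesForm w a m ^ (-σ₀), fun s h0 h1 ↦ ?_⟩
  rw [barnesCont_eq_series hw (h.trans_le h0) ha]
  exact tsum_of_norm_bounded
    ((summable_rpow_barnesForm hw h ha).mul_left (max 1 (a ^ (-(σ₁ - σ₀))))).hasSum
    fun m ↦ norm_cpow_barnesForm_le hw hσ₀ ha le_rfl h0 h1 m

theorem isBarnesContinuation_barnesCont {r : ℕ} {w : Fin r → ℝ} (hw : ∀ j, 0 < w j) {a : ℝ}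
    (ha : 0 < a) : IsBarnesContinuation r a w (fun s ↦ barnesCont w s a) where
  hasSum s hs := by
    simp only [barnesCont_eq_series hw hs ha, one_div, ← Complex.cpow_neg]
    exact hasSum_barnesSeries hw hs ha
  meromorphic s :=
    (((isBarnesNumerator_barnesNumerator hw).differentiable ha).analyticAt s).meromorphicAt.div
      ((differentiable_barnesDenom r).analyticAt s).meromorphicAt
  differentiableOn :=
    ((isBarnesNumerator_barnesNumerator hw).differentiable ha).differentiableOn.div
      (differentiable_barnesDenom r).differentiableOn fun _ hs ↦ barnesDenom_ne_zero hs

theorem isOpen_isPreconnected_ne_natCast (r : ℕ) :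
    IsOpen {s : ℂ | ∀ k : ℕ, 1 ≤ k → k ≤ r → s ≠ (k : ℂ)} ∧
      IsPreconnected {s : ℂ | ∀ k : ℕ, 1 ≤ k → k ≤ r → s ≠ (k : ℂ)} := by
  have hcompl : {s : ℂ | ∀ k : ℕ, 1 ≤ k → k ≤ r → s ≠ (k : ℂ)} =
      ((fun k : ℕ ↦ (k : ℂ)) '' Icc 1 r)ᶜ := by
    ext s
    simp only [mem_ofPred_eq, mem_compl_iff, mem_image, mem_Icc, not_exists, not_and, and_imp,
      ne_comm, ne_eq]
  have hfin : ((fun k : ℕ ↦ (k : ℂ)) '' Icc 1 r).Finite := (finite_Icc 1 r).image _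
  rw [hcompl]
  refine ⟨hfin.isClosed.isOpen_compl,
    (hfin.countable.isConnected_compl_of_one_lt_rank ?_).isPreconnected⟩
  rw [Complex.rank_real_complex]
  norm_num

theorem IsBarnesContinuation.eqOn {r : ℕ} {a : ℝ} {w : Fin r → ℝ} {Z Z' : ℂ → ℂ}
    (hZ : IsBarnesContinuation r a w Z) (hZ' : IsBarnesContinuation r a w Z') :
    EqOn Z Z' {s : ℂ | ∀ k : ℕ, 1 ≤ k → k ≤ r → s ≠ (k : ℂ)} := by
  obtain ⟨hopen, hconn⟩ := isOpen_isPreconnected_ne_natCast r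
  have hmem : (((r : ℝ) + 1 : ℝ) : ℂ) ∈ {s : ℂ | ∀ k : ℕ, 1 ≤ k → k ≤ r → s ≠ (k : ℂ)} := by
    intro k _ hk h
    have hre := congrArg Complex.re h
    rw [Complex.ofReal_re, Complex.natCast_re] at hre
    exact absurd hk (by exact_mod_cast (hre ▸ lt_add_one (r : ℝ)).not_ge)
  have hnhds : {s : ℂ | (r : ℝ) < s.re} ∈ 𝓝 (((r : ℝ) + 1 : ℝ) : ℂ) :=
    (isOpen_setOf_lt_re r).mem_nhds (lt_add_one (r : ℝ))
  refine AnalyticOnNhd.eqOn_of_preconnected_of_eventuallyEq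
    (hZ.differentiableOn.analyticOnNhd hopen) (hZ'.differentiableOn.analyticOnNhd hopen) hconn
    hmem ?_
  filter_upwards [hnhds] with s hs using (hZ.hasSum s hs).unique (hZ'.hasSum s hs)

theorem isBarnesContinuation_barnesZeta {r : ℕ} {w : Fin r → ℝ} (hw : ∀ j, 0 < w j) {a : ℝ}
    (ha : 0 < a) : IsBarnesContinuation r a w (barnesZeta r a w) := by
  have hex : ∃ Z, IsBarnesContinuation r a w Z := ⟨_, isBarnesContinuation_barnesCont hw ha⟩
  rw [barnesZeta, dif_pos hex]
  exact hex.choose_spec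

theorem barnesZeta_eq_barnesCont {r : ℕ} {w : Fin r → ℝ} (hw : ∀ j, 0 < w j) {a : ℝ}
    (ha : 0 < a) {s : ℂ} (hs : s.im ≠ 0) : barnesZeta r a w s = barnesCont w s a :=
  (isBarnesContinuation_barnesZeta hw ha).eqOn (isBarnesContinuation_barnesCont hw ha)
    fun k _ _ h ↦ hs (by rw [h, Complex.natCast_im])

theorem theorem1p4 (r : ℕ) (hr : 1 ≤ r) (a : ℝ) (ha : 0 < a)
    (w : Fin r → ℝ) (hw : ∀ j, 0 < w j) :
    IsBarnesContinuation r a w (barnesZeta r a w) ∧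
    (∀ σ₀ σ₁ : ℝ, (r : ℝ) < σ₀ → ∃ C : ℝ, ∀ σ t : ℝ, σ₀ ≤ σ → σ ≤ σ₁ → 2 ≤ t →
      ‖barnesZeta r a w (σ + t * Complex.I)‖ ≤ C) ∧
    (∃ C : ℝ, ∀ σ t : ℝ, (r : ℝ) - 1 < σ → σ ≤ r → 2 ≤ t →
      ‖barnesZeta r a w (σ + t * Complex.I)‖ ≤ C * (t ^ (((r : ℝ) - σ) / 2) * Real.log t)) ∧
    (∀ σ₀ : ℝ, ∃ C : ℝ, ∀ σ t : ℝ, σ₀ ≤ σ → σ ≤ (r : ℝ) - 1 → 2 ≤ t →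
      ‖barnesZeta r a w (σ + t * Complex.I)‖ ≤
        C * (t ^ ((r : ℝ) - σ - 1 / 2) * Real.log t)) := by
  obtain ⟨r, rfl⟩ := Nat.exists_eq_succ_of_ne_zero (Nat.one_le_iff_ne_zero.1 hr)
  have heq (σ t : ℝ) (ht : 2 ≤ t) :
      barnesZeta (r + 1) a w (σ + t * Complex.I) = barnesCont w (σ + t * Complex.I) a :=
    barnesZeta_eq_barnesCont hw ha (by simpa using (two_pos.trans_le ht).ne')
  refine ⟨isBarnesContinuation_barnesZeta hw ha, fun σ₀ σ₁ h ↦ ?_, ?_, fun σ₀ ↦ ?_⟩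
  · obtain ⟨C, hC⟩ := norm_barnesCont_right_le hw ha h σ₁
    refine ⟨C, fun σ t h0 h1 ht ↦ ?_⟩
    rw [heq σ t ht]
    exact hC _ (by simpa using h0) (by simpa using h1)
  · obtain ⟨C, hC⟩ := norm_barnesCont_critical_strip_le hw ha
    refine ⟨C, fun σ t h0 h1 ht ↦ ?_⟩
    rw [heq σ t ht]
    simpa using hC (σ + t * Complex.I) (by simpa using h0) (by simpa using h1) (by simpa using ht)
  · obtain ⟨C, hC⟩ := norm_barnesCont_left_le hw ha σ₀
    refine ⟨C, fun σ t h0 h1 ht ↦ ?_⟩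
    rw [heq σ t ht]
    simpa using hC (σ + t * Complex.I) (by simpa using h0) (by simpa using h1) (by simpa using ht)
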